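/- For $c_0>0$ let $X(s,t),T(s,t),n(s,t),b(s,t)\in\mathbb R^3$ ($s\in\mathbb R$, $t>0$) be the self-similar one-corner solution of the vortex filament equation $X_t=X_s\wedge X_{ss}$, i.e. for each $t>0$ the solution of $$X_s=T,\qquad T_s=\tfrac{c_0}{\sqrt t}\,n,\qquad n_s=-\tfrac{c_0}{\sqrt t}\,T+\tfrac{s}{2t}\,b,\qquad b_s=-\tfrac{s}{2t}\,n,$$ with $X(0,t)=2c_0\sqrt t\,(0,0,1)$, $T(0,t)=(1,0,0)$, $n(0,t)=(0,1,0)$, $b(0,t)=(0,0,1)$. **(a)** The limits $A^\pm=\lim_{s\to\pm\infty}T(s,1)$ exist, $A^-\wedge A^+\neq0$, and, with $e_0=(A^-\wedge A^+)/|A^-\wedge A^+|$ and $X_{rot}(s)=e_0\cdot X(s,1)$, the function $X_{rot}$ is integrable on $\mathbb R$ and $$\int_{-\infty}^{\infty}X_{rot}(s)\,ds=\frac{2\pi c_0^2}{\sqrt{e^{\pi c_0^2}-1}} .$$ **(b)** Let $M\ge3$ be an integer and suppose $c_0=\left[-\frac2\pi\ln\cos\frac\pi M\right]^{1/2}$.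 Write $A^+=(A_1,A_2,A_3)$, $r=\sqrt{A_2^2+A_3^2}$, and let $$\mathbf X_{rot}(s,t)=\begin{pmatrix}-\pi/M\\-\frac{\pi/M}{\tan(\pi/M)}\\0\end{pmatrix}+\begin{pmatrix}\cos\frac\pi M&\sin\frac\pi M&0\\-\sin\frac\pi M&\cos\frac\pi M&0\\0&0&1\end{pmatrix}\begin{pmatrix}1&0&0\\0&A_2/r&A_3/r\\0&-A_3/r&A_2/r\end{pmatrix}X(s,t)$$ be the one-corner solution placed at the corner $s=0$ of the regular $M$-gon of perimeter $2\pi$. Its third component satisfies $X_{rot,3}(s,1)=X_{rot}(s)$ and $$\frac M{2\pi}\int_{-\infty}^\infty X_{rot,3}(s,1)\,ds=\frac{\ln(1+\tan^2(\pi/M))}{(\pi/M)\tan(\pi/M)} .$$ Consequently, let $X_M(s,t)$ be any time-dependent curve in $\mathbb R^3$ (in particular the evolution of the regular $M$-gon under the vortex filament equation) whose centre of mass rises with constant velocity $c_M$, that is $\frac1{2\pi}\int_0^{2\pi}X_{M,3}(s,t)\,ds=c_Mt$ for all $t>0$. If $X_M$ is linked to the one-corner problem in the conjectured way, $$\lim_{t\to0^+}\frac1t\left(\frac1{2\pi}\int_0^{2\pi}X_{M,3}(s,t)\,ds-\frac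 M{2\pi}\int_{-\pi/M}^{\pi/M}X_{rot,3}(s,t)\,ds\right)=0,$$ then $$c_M=\frac{\ln(1+\tan^2(\pi/M))}{(\pi/M)\tan(\pi/M)} .$$ -/

import Mathlib

open Filter Topology MeasureTheory

noncomputable section

namespace VortexFilament

/-- Three-dimensional Euclidean space. -/
abbrev E3 : Type := EuclideanSpace ℝ (Fin 3)

/-- The usual cross product `u ∧ v` of vectors of `ℝ³`. -/
def cross (u v : E3) : E3 := WithLp.toLp 2 (crossProduct u.ofLp v.ofLp)

/-- The self-similar one-corner solution of the vortex filament equation with parameter `c₀`: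
the curve `X s t` and its orthonormal frame `T s t`, `n s t`, `b s t`. For every time `t > 0` they
solve the Frenet system with curvature `c₀ / √t` and torsion `s / (2 t)`, with prescribed values
at `s = 0`. Nothing is required of the values at times `t ≤ 0`. -/
structure IsOneCornerSolution (c₀ : ℝ) (X T n b : ℝ → ℝ → E3) : Prop where
  hasDerivAt_X : ∀ t, 0 < t → ∀ s, HasDerivAt (fun σ => X σ t) (T s t) s
  hasDerivAt_T : ∀ t, 0 < t → ∀ s, HasDerivAt (fun σ => T σ t) ((c₀ / √t) • n s t) s
  hasDerivAt_n : ∀ t, 0 < t → ∀ s,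
    HasDerivAt (fun σ => n σ t) (-(c₀ / √t) • T s t + (s / (2 * t)) • b s t) s
  hasDerivAt_b : ∀ t, 0 < t → ∀ s, HasDerivAt (fun σ => b σ t) (-(s / (2 * t)) • n s t) s
  X_zero : ∀ t, 0 < t → X 0 t = (2 * c₀ * √t) • !₂[0, 0, 1]
  T_zero : ∀ t, 0 < t → T 0 t = !₂[1, 0, 0]
  n_zero : ∀ t, 0 < t → n 0 t = !₂[0, 1, 0]
  b_zero : ∀ t, 0 < t → b 0 t = !₂[0, 0, 1]

/-- The unit vector `e₀` in the direction of `A⁻ ∧ A⁺`. -/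
def unitNormal (Am Ap : E3) : E3 := ‖cross Am Ap‖⁻¹ • cross Am Ap

/-- `X_rot(s)`: the component along `e₀` of the position vector at time `1`. -/
def normalComponent (Am Ap : E3) (X : ℝ → ℝ → E3) (s : ℝ) : ℝ :=
  inner ℝ (unitNormal Am Ap) (X s 1)

/-- The rotation that takes a one-corner solution whose limiting tangents are
`(A₁, ∓A₂, ∓A₃)` to the position of a corner of the regular `M`-gon in the horizontal plane. -/
def cornerRotation (M : ℕ) (Ap : E3) : Matrix (Fin 3) (Fin 3) ℝ :=
  let r : ℝ := √(Ap 1 ^ 2 + Ap 2 ^ 2)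
  !![Real.cos (Real.pi / M), Real.sin (Real.pi / M), 0;
     -Real.sin (Real.pi / M), Real.cos (Real.pi / M), 0;
     0, 0, 1] *
  !![1, 0, 0;
     0, Ap 1 / r, Ap 2 / r;
     0, -Ap 2 / r, Ap 1 / r]

/-- The one-corner solution moved rigidly to the corner at `s = 0` of the regular `M`-gon of
perimeter `2π` centred at the origin of the horizontal plane. -/
def rotatedSolution (M : ℕ) (Ap : E3) (X : ℝ → ℝ → E3) (s t : ℝ) : E3 :=
  !₂[-(Real.pi / M), -((Real.pi / M) / Real.tan (Real.pi / M)), 0] +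
    WithLp.toLp 2 ((cornerRotation M Ap).mulVec (X s t).ofLp)

/-- The centre of mass of the closed curves `s ↦ Y s t`, `0 ≤ s ≤ 2π` (parameterized by
arc length), moves upwards with constant velocity `c`, starting from height `0`. -/
def HasVerticalVelocity (Y : ℝ → ℝ → E3) (c : ℝ) : Prop :=
  ∀ t, 0 < t → (1 / (2 * Real.pi)) * ∫ s in (0 : ℝ)..(2 * Real.pi), Y s t 2 = c * t

/-- The conjectured link between a motion `Y` starting from the regular `M`-gon of perimeter `2π`
and the rotated one-corner solution `Z`: at infinitesimal times the rise of the centre of mass of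
`Y` is that of `Z` over the part `-π/M ≤ s ≤ π/M` around one corner, up to an error `o(t)`. -/
def HeightLink (M : ℕ) (Y Z : ℝ → ℝ → E3) : Prop :=
  Tendsto (fun t : ℝ => (1 / t) *
    ((1 / (2 * Real.pi)) * (∫ s in (0 : ℝ)..(2 * Real.pi), Y s t 2) -
      (M / (2 * Real.pi)) * ∫ s in (-(Real.pi / M))..(Real.pi / M), Z s t 2))
    (𝓝[>] 0) (𝓝 0)

end VortexFilament

end

noncomputable section

namespace VortexFilament

/-! ### A parabolic cylinder integral -/

/-! At time `1` the coordinate rows `(T i, n i, b i)` of the frame solve one linear system, whose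
flow preserves dot and cross products of solutions, and `X = s T + 2 c b` with `c = c₀`. Reflection
in `s` gives `A⁻ = (A₁, -A₂, -A₃)`, so `e₀` is parallel to `(0, -A₃, A₂)`. Along this direction the
tangent component `x` tends to `0`, and `f = s x + 2 c z` is even and `O(s⁻²)`. Since `(s f)' = 2 f
- 2 c z`, the integral of `f` over `ℝ` equals `2 c ∫₀^∞ z`, with `z` the binormal component
(`FrenetOn.integral_position`).

The binormal integral comes from differentiating in the curvature. For each `k` there is an explicit
solution `(blochX k, blochY k, blochZ k)` of curvature `k` on `s > 0`, tending to `(1, 0, 0)` at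
infinity. Its dot product with row `0` of the frame of curvature `c` has derivative `(k - c) (blochY
k * T 0 - blochX k * n 0)`. It starts from `exp (-π k² / 2)` at `0⁺` and tends to `A₁ = exp (-π c² /
2)`. Dividing by `k - c` and letting `k → c` gives `π c exp (-π c² / 2)` for the integral of the
bracket at `k = c`, which is `z` up to normalization (`FrameRows.bloch_cross_eq`). The exchange of
limits rests on the `O(1/S)` tail bound `FrameRows.pairing_tail`.

The explicit solution is quadratic in a spinor whose amplitudes are parabolic cylinder integrals of
exponents `i k² / 2` and `i k² / 2 - 1`. Conservation of the spinor mass normalizes it, and the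
reflection formula for Gamma gives its value at the origin.

For the polygon, the choice of `c₀` means `A₁ = cos (π / M)` and `r = sin (π / M)`. Self-similarity
turns the height integral over one side into `t` times the integral of the profile over a window
that exhausts `ℝ` as `t → 0⁺`. -/

/-- The affine complex line through `s` in the direction `1 - i`. -/
def cylLine (s y : ℝ) : ℂ := (s : ℂ) + (1 - Complex.I) * y

/-- The integrand of the parabolic cylinder integral. -/
def cylKernel (p : ℂ) (s y : ℝ) : ℂ := cylLine s y ^ p * (Real.exp (-(1 / 2) * y ^ 2) : ℂ)

/-- The parabolic cylinder integral `∫ (s + (1 - i) y) ^ p exp (-y² / 2) dy`. -/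
def cylIntegral (p : ℂ) (s : ℝ) : ℂ := ∫ y, cylKernel p s y

lemma cylLine_re (s y : ℝ) : (cylLine s y).re = s + y := by simp [cylLine]

lemma cylLine_im (s y : ℝ) : (cylLine s y).im = -y := by simp [cylLine]

lemma half_le_norm_cylLine (s y : ℝ) : s / 2 ≤ ‖cylLine s y‖ := by
  rw [Complex.norm_eq_sqrt_sq_add_sq, cylLine_re, cylLine_im]
  apply Real.le_sqrt_of_sq_le
  nlinarith [sq_nonneg (s + 2 * y), sq_nonneg s]

lemma cylLine_mem_slitPlane {s : ℝ} (hs : 0 < s) (y : ℝ) : cylLine s y ∈ Complex.slitPlane := by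
  rw [Complex.mem_slitPlane_iff, cylLine_re, cylLine_im]
  by_cases hy : y = 0
  · left; simp [hy, hs]
  · right; simpa using hy

lemma cylLine_mem_slitPlane_of_ne {y : ℝ} (hy : y ≠ 0) (s : ℝ) :
    cylLine s y ∈ Complex.slitPlane := by
  rw [Complex.mem_slitPlane_iff, cylLine_im]
  right; simpa using hy

lemma inv_exp_arg_le (z : ℂ) (v : ℝ) : (Real.exp (z.arg * v))⁻¹ ≤ Real.exp (Real.pi * |v|) := by
  rw [← Real.exp_neg, Real.exp_le_exp, ← neg_mul]
  calc -z.arg * v ≤ |-z.arg * v| := le_abs_self _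
    _ = |z.arg| * |v| := by rw [abs_mul, abs_neg]
    _ ≤ _ := mul_le_mul_of_nonneg_right (Complex.abs_arg_le_pi z) (abs_nonneg _)

lemma norm_cylLine_cpow_le {p : ℂ} (hp : p.re ≤ 0) {σ s : ℝ} (hσ : 0 < σ) (hs : σ ≤ s) (y : ℝ) :
    ‖cylLine s y ^ p‖ ≤ (σ / 2) ^ p.re * Real.exp (Real.pi * |p.im|) := by
  refine (Complex.norm_cpow_le _ _).trans ?_
  rw [div_eq_mul_inv]
  refine mul_le_mul ?_ (inv_exp_arg_le _ _) (by positivity) (by positivity)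
  refine Real.rpow_le_rpow_of_nonpos (by positivity) ?_ hp
  have := half_le_norm_cylLine s y
  linarith

lemma norm_cpow_le_of_re_eq_zero {p : ℂ} (hp : p.re = 0) (z : ℂ) :
    ‖z ^ p‖ ≤ Real.exp (Real.pi * |p.im|) := by
  refine (Complex.norm_cpow_le _ _).trans ?_
  rw [div_eq_mul_inv, hp, Real.rpow_zero, one_mul]
  exact inv_exp_arg_le _ _

lemma norm_cylKernel (p : ℂ) (s y : ℝ) :
    ‖cylKernel p s y‖ = ‖cylLine s y ^ p‖ * Real.exp (-(1 / 2) * y ^ 2) := by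
  rw [cylKernel, norm_mul, Complex.norm_real, Real.norm_of_nonneg (Real.exp_pos _).le]

lemma norm_cylKernel_le {p : ℂ} (hp : p.re ≤ 0) {σ s : ℝ} (hσ : 0 < σ) (hs : σ ≤ s) (y : ℝ) :
    ‖cylKernel p s y‖ ≤
      (σ / 2) ^ p.re * Real.exp (Real.pi * |p.im|) * Real.exp (-(1 / 2) * y ^ 2) := by
  rw [norm_cylKernel]
  exact mul_le_mul_of_nonneg_right (norm_cylLine_cpow_le hp hσ hs y) (Real.exp_pos _).le

lemma integrable_gauss_half (C : ℝ) : Integrable fun y : ℝ => C * Real.exp (-(1 / 2) * y ^ 2) :=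
  (integrable_exp_neg_mul_sq (by norm_num)).const_mul _

lemma measurable_cylKernel (p : ℂ) (s : ℝ) : Measurable (cylKernel p s) := by
  unfold cylKernel cylLine
  fun_prop

lemma integrable_cylKernel {p : ℂ} (hp : p.re ≤ 0) {s : ℝ} (hs : 0 < s) :
    Integrable (cylKernel p s) :=
  (integrable_gauss_half _).mono' (measurable_cylKernel p s).aestronglyMeasurable
    (Eventually.of_forall fun y => norm_cylKernel_le hp hs le_rfl y)

lemma integral_gauss_half : ∫ y : ℝ, Real.exp (-(1 / 2) * y ^ 2) = √(2 * Real.pi) := by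
  rw [integral_gaussian]; congr 1; ring

lemma norm_cylIntegral_le {p : ℂ} (hp : p.re ≤ 0) {s : ℝ} (hs : 0 < s) :
    ‖cylIntegral p s‖ ≤ (s / 2) ^ p.re * Real.exp (Real.pi * |p.im|) * √(2 * Real.pi) := by
  rw [← integral_gauss_half, ← integral_const_mul]
  exact norm_integral_le_of_norm_le (integrable_gauss_half _)
    (Eventually.of_forall fun y => norm_cylKernel_le hp hs le_rfl y)

lemma hasDerivAt_cylKernel (p : ℂ) {s : ℝ} (hs : 0 < s) (y : ℝ) :
    HasDerivAt (fun σ => cylKernel p σ y) (p * cylKernel (p - 1) s y) s := by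
  have h1 : HasDerivAt (fun z : ℂ => z + (1 - Complex.I) * y) 1 (s : ℂ) :=
    (hasDerivAt_id _).add_const _
  have h2 := (h1.cpow_const (c := p) (cylLine_mem_slitPlane hs y)).comp_ofReal
  have h3 := h2.mul_const (Real.exp (-(1 / 2) * y ^ 2) : ℂ)
  refine h3.congr_deriv ?_
  simp only [cylKernel, cylLine]; ring

lemma hasDerivAt_cylIntegral {p : ℂ} (hp : p.re ≤ 0) {s : ℝ} (hs : 0 < s) :
    HasDerivAt (cylIntegral p) (p * cylIntegral (p - 1) s) s := by
  have hp1 : (p - 1).re ≤ 0 := by simp; linarith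
  have key := hasDerivAt_integral_of_dominated_loc_of_deriv_le (μ := volume)
    (F := fun σ y => cylKernel p σ y) (F' := fun σ y => p * cylKernel (p - 1) σ y)
    -- For `σ > s / 2` the line stays at distance at least `s / 4` from the origin, which gives one
    -- bound for all these `σ`.
    (x₀ := s) (s := Set.Ioi (s / 2))
    (bound := fun y => ‖p‖ * ((s / 2 / 2) ^ (p - 1).re * Real.exp (Real.pi * |(p - 1).im|)) *
      Real.exp (-(1 / 2) * y ^ 2))
    (Ioi_mem_nhds (by linarith))
    (Eventually.of_forall fun σ => (measurable_cylKernel p σ).aestronglyMeasurable)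
    (integrable_cylKernel hp hs)
    ((measurable_cylKernel (p - 1) s).const_mul p).aestronglyMeasurable
    (Eventually.of_forall fun y σ hσ => by
      rw [norm_mul, mul_assoc]
      exact mul_le_mul_of_nonneg_left
        (norm_cylKernel_le hp1 (by positivity) (le_of_lt hσ) y) (norm_nonneg _))
    (integrable_gauss_half _)
    (Eventually.of_forall fun y σ hσ =>
      hasDerivAt_cylKernel p (lt_trans (by positivity) (Set.mem_Ioi.1 hσ)) y)
  refine key.2.congr_deriv ?_
  rw [integral_const_mul]; rfl

/-- The three-term recurrence of the parabolic cylinder integrals. -/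
lemma cylIntegral_recurrence {p : ℂ} (hp : p.re ≤ -1) {s : ℝ} (hs : 0 < s) :
    p * cylIntegral (p - 1) s = Complex.I / 2 * (cylIntegral (p + 1) s - s * cylIntegral p s) := by
  have i0 := integrable_cylKernel (p := p) (by linarith) hs
  have i1 := integrable_cylKernel (p := p - 1) (by simp; linarith) hs
  have i2 := integrable_cylKernel (p := p + 1) (by simp; linarith) hs
  -- The recurrence is an integration by parts: the derivative in `y` has integral zero. The factor
  -- `y` from the Gaussian is `(1 - i) (i / 2) (cylLine s y - s)`, because `(1 - i)² = -2 i`.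
  have hder : ∀ y : ℝ, HasDerivAt (cylKernel p s)
      ((1 - Complex.I) * (p * cylKernel (p - 1) s y - Complex.I / 2 *
        (cylKernel (p + 1) s y - s * cylKernel p s y))) y := by
    intro y
    have hm := cylLine_mem_slitPlane hs y
    have h1 : HasDerivAt (fun z : ℂ => (s : ℂ) + (1 - Complex.I) * z) (1 - Complex.I) (y : ℂ) := by
      simpa using ((hasDerivAt_id (y : ℂ)).const_mul (1 - Complex.I)).const_add (s : ℂ)
    have h2 := (h1.cpow_const (c := p) hm).comp_ofReal
    have h3 : HasDerivAt (fun y : ℝ => Real.exp (-(1 / 2) * y ^ 2))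
        (Real.exp (-(1 / 2) * y ^ 2) * (-y)) y := by
      have := (((hasDerivAt_id y).pow 2).const_mul (-(1 / 2) : ℝ)).exp
      refine this.congr_deriv ?_
      simp
    have h4 := h2.mul h3.ofReal_comp
    refine h4.congr_deriv ?_
    have hz : cylLine s y ≠ 0 := Complex.slitPlane_ne_zero hm
    have e1 : cylLine s y ^ (p + 1) = cylLine s y ^ p * cylLine s y := by
      rw [Complex.cpow_add _ _ hz, Complex.cpow_one]
    simp only [cylKernel, e1]
    simp only [cylLine]
    push_cast
    linear_combination ((1 / 2 : ℂ) * (y : ℂ) *  ((s : ℂ) + (1 - Complex.I) * y) ^ p *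
      Complex.exp (-(1 / 2) * (y : ℂ) ^ 2) * (-2 + Complex.I)) * Complex.I_sq
  have hint : Integrable fun y => (1 - Complex.I) * (p * cylKernel (p - 1) s y - Complex.I / 2 *
        (cylKernel (p + 1) s y - s * cylKernel p s y)) :=
    ((i1.const_mul p).sub ((i2.sub (i0.const_mul (s : ℂ))).const_mul _)).const_mul _
  have h := integral_eq_zero_of_hasDerivAt_of_integrable hder hint i0
  have i3 : Integrable fun y => (s : ℂ) * cylKernel p s y := i0.const_mul _
  have i4 : Integrable fun y => Complex.I / 2 * (cylKernel (p + 1) s y - s * cylKernel p s y) :=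
    (i2.sub i3).const_mul _
  rw [integral_const_mul, integral_sub (i1.const_mul p) i4, integral_const_mul,
    integral_const_mul, integral_sub i2 i3, integral_const_mul] at h
  have h1 : (1 - Complex.I : ℂ) ≠ 0 := fun h => by
    have := congrArg Complex.re h; simp at this
  exact sub_eq_zero.1 ((mul_eq_zero.1 h).resolve_left h1)

/-! ### The spinor form of the Frenet system and its explicit solution. -/

lemma hasDerivAt_complex_re {f : ℝ → ℂ} {f' : ℂ} {s : ℝ} (h : HasDerivAt f f' s) :
    HasDerivAt (fun σ => (f σ).re) f'.re s :=
  Complex.reCLM.hasFDerivAt.comp_hasDerivAt s h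

lemma hasDerivAt_complex_im {f : ℝ → ℂ} {f' : ℂ} {s : ℝ} (h : HasDerivAt f f' s) :
    HasDerivAt (fun σ => (f σ).im) f'.im s :=
  Complex.imCLM.hasFDerivAt.comp_hasDerivAt s h

/-- The scalar Frenet system with curvature `k` and torsion `s / 2` on a set of arc lengths. -/
structure FrenetOn (k : ℝ) (S : Set ℝ) (x y z : ℝ → ℝ) : Prop where
  dx : ∀ s ∈ S, HasDerivAt x (k * y s) s
  dy : ∀ s ∈ S, HasDerivAt y (-k * x s + s / 2 * z s) s
  dz : ∀ s ∈ S, HasDerivAt z (-(s / 2) * y s) s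

/-- The exponent `i k² / 2`. -/
def cylExp (k : ℝ) : ℂ := ((k ^ 2 / 2 : ℝ) : ℂ) * Complex.I

lemma cylExp_re (k : ℝ) : (cylExp k).re = 0 := by
  rw [cylExp, Complex.re_ofReal_mul, Complex.I_re, mul_zero]

lemma cylExp_im (k : ℝ) : (cylExp k).im = k ^ 2 / 2 := by
  rw [cylExp, Complex.im_ofReal_mul, Complex.I_im, mul_one]

lemma cylExp_sub_one_re (k : ℝ) : (cylExp k - 1).re = -1 := by simp [cylExp_re]

lemma cylExp_sub_one_im (k : ℝ) : (cylExp k - 1).im = k ^ 2 / 2 := by simp [cylExp_im]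

/-- The first spinor amplitude. -/
def spinB (k s : ℝ) : ℂ := cylIntegral (cylExp k) s

/-- The second spinor amplitude. -/
def spinA (k s : ℝ) : ℂ := cylIntegral (cylExp k - 1) s

/-- First component of the explicit Frenet solution that tends to `(1, 0, 0)` at `+∞`. -/
def blochX (k s : ℝ) : ℝ :=
  (2 * Real.pi)⁻¹ * ((spinB k s).re ^ 2 + (spinB k s).im ^ 2 -
    k ^ 2 * ((spinA k s).re ^ 2 + (spinA k s).im ^ 2))

/-- Second component of the explicit Frenet solution that tends to `(1, 0, 0)` at `+∞`. -/
def blochY (k s : ℝ) : ℝ :=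
  (2 * Real.pi)⁻¹ * (2 * k * ((spinB k s).im * (spinA k s).re - (spinB k s).re * (spinA k s).im))

/-- Third component of the explicit Frenet solution that tends to `(1, 0, 0)` at `+∞`. -/
def blochZ (k s : ℝ) : ℝ :=
  (2 * Real.pi)⁻¹ * (2 * k * ((spinB k s).re * (spinA k s).re + (spinB k s).im * (spinA k s).im))

lemma hasDerivAt_spinB (k : ℝ) {s : ℝ} (hs : 0 < s) :
    HasDerivAt (spinB k) (cylExp k * spinA k s) s :=
  hasDerivAt_cylIntegral (cylExp_re k).le hs

lemma hasDerivAt_spinA (k : ℝ) {s : ℝ} (hs : 0 < s) :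
    HasDerivAt (spinA k) (Complex.I / 2 * (spinB k s - s * spinA k s)) s := by
  refine (hasDerivAt_cylIntegral (p := cylExp k - 1) (by simp [cylExp_re]) hs).congr_deriv ?_
  rw [cylIntegral_recurrence (by simp [cylExp_re]) hs, sub_add_cancel]; rfl

lemma hasDerivAt_spinB_re (k : ℝ) {s : ℝ} (hs : 0 < s) :
    HasDerivAt (fun σ => (spinB k σ).re) (-(k ^ 2 / 2) * (spinA k s).im) s := by
  refine (hasDerivAt_complex_re (hasDerivAt_spinB k hs)).congr_deriv ?_
  rw [Complex.mul_re, cylExp_re, cylExp_im]; ring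

lemma hasDerivAt_spinB_im (k : ℝ) {s : ℝ} (hs : 0 < s) :
    HasDerivAt (fun σ => (spinB k σ).im) (k ^ 2 / 2 * (spinA k s).re) s := by
  refine (hasDerivAt_complex_im (hasDerivAt_spinB k hs)).congr_deriv ?_
  rw [Complex.mul_im, cylExp_re, cylExp_im]; ring

lemma hasDerivAt_spinA_re (k : ℝ) {s : ℝ} (hs : 0 < s) :
    HasDerivAt (fun σ => (spinA k σ).re) (-((spinB k s).im - s * (spinA k s).im) / 2) s := by
  refine (hasDerivAt_complex_re (hasDerivAt_spinA k hs)).congr_deriv ?_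
  simp; ring

lemma hasDerivAt_spinA_im (k : ℝ) {s : ℝ} (hs : 0 < s) :
    HasDerivAt (fun σ => (spinA k σ).im) (((spinB k s).re - s * (spinA k s).re) / 2) s := by
  refine (hasDerivAt_complex_im (hasDerivAt_spinA k hs)).congr_deriv ?_
  simp; ring

/-- This is the passage from SU(2) to SO(3) for the spinor `(B, k A)`: up to the factor `1 / (2π)`,
the first component is `|B|² - k² |A|²`, and `Z + i Y` is `2 k B` times the conjugate of `A`. -/
lemma frenetOn_bloch (k : ℝ) : FrenetOn k (Set.Ioi 0) (blochX k) (blochY k) (blochZ k) := by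
  constructor <;> intro s hs
  · have h1 := hasDerivAt_spinB_re k hs
    have h2 := hasDerivAt_spinB_im k hs
    have h3 := hasDerivAt_spinA_re k hs
    have h4 := hasDerivAt_spinA_im k hs
    refine ((((h1.pow 2).add (h2.pow 2)).sub
      (((h3.pow 2).add (h4.pow 2)).const_mul (k ^ 2))).const_mul (2 * Real.pi)⁻¹).congr_deriv ?_
    simp only [blochY]; push_cast; ring
  · have h1 := hasDerivAt_spinB_re k hs
    have h2 := hasDerivAt_spinB_im k hs
    have h3 := hasDerivAt_spinA_re k hs
    have h4 := hasDerivAt_spinA_im k hs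
    refine ((((h2.mul h3).sub (h1.mul h4)).const_mul (2 * k)).const_mul
      (2 * Real.pi)⁻¹).congr_deriv ?_
    simp only [blochX, blochZ]; ring
  · have h1 := hasDerivAt_spinB_re k hs
    have h2 := hasDerivAt_spinB_im k hs
    have h3 := hasDerivAt_spinA_re k hs
    have h4 := hasDerivAt_spinA_im k hs
    refine ((((h1.mul h3).add (h2.mul h4)).const_mul (2 * k)).const_mul
      (2 * Real.pi)⁻¹).congr_deriv ?_
    simp only [blochY]; ring

lemma eq_of_hasDerivAt_zero_Ioi {f : ℝ → ℝ} (hf : ∀ s, 0 < s → HasDerivAt f 0 s) {s t : ℝ}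
    (hs : 0 < s) (ht : 0 < t) : f s = f t :=
  (convex_Ioi (0 : ℝ)).is_const_of_fderivWithin_eq_zero (𝕜 := ℝ)
    (fun x hx => (hf x hx).differentiableAt.differentiableWithinAt)
    (fun x hx => by
      have h := (hf x hx).hasFDerivAt.hasFDerivWithinAt (s := Set.Ioi (0 : ℝ))
      rw [h.fderivWithin (isOpen_Ioi.uniqueDiffWithinAt hx)]; ext; simp) hs ht

/-- The total squared amplitude of the spinor. -/
def spinMass (k s : ℝ) : ℝ :=
  (spinB k s).re ^ 2 + (spinB k s).im ^ 2 + k ^ 2 * ((spinA k s).re ^ 2 + (spinA k s).im ^ 2)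

lemma hasDerivAt_spinMass (k : ℝ) {s : ℝ} (hs : 0 < s) : HasDerivAt (spinMass k) 0 s := by
  have h1 := hasDerivAt_spinB_re k hs
  have h2 := hasDerivAt_spinB_im k hs
  have h3 := hasDerivAt_spinA_re k hs
  have h4 := hasDerivAt_spinA_im k hs
  refine ((((h1.pow 2).add (h2.pow 2)).add
      (((h3.pow 2).add (h4.pow 2)).const_mul (k ^ 2)))).congr_deriv ?_
  push_cast; ring

lemma norm_spinB_le (k : ℝ) {s : ℝ} (hs : 0 < s) :
    ‖spinB k s‖ ≤ Real.exp (Real.pi * (k ^ 2 / 2)) * √(2 * Real.pi) := by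
  refine (norm_cylIntegral_le (cylExp_re k).le hs).trans (le_of_eq ?_)
  rw [cylExp_re, cylExp_im, Real.rpow_zero, one_mul, abs_of_nonneg (by positivity)]

lemma norm_spinA_le (k : ℝ) {s : ℝ} (hs : 0 < s) :
    ‖spinA k s‖ ≤ 2 / s * (Real.exp (Real.pi * (k ^ 2 / 2)) * √(2 * Real.pi)) := by
  refine (norm_cylIntegral_le (p := cylExp k - 1) (by simp [cylExp_re]) hs).trans (le_of_eq ?_)
  rw [cylExp_sub_one_re, cylExp_sub_one_im, Real.rpow_neg_one, inv_div,
    abs_of_nonneg (by positivity), mul_assoc]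

lemma norm_sq_eq_re_im (z : ℂ) : z.re ^ 2 + z.im ^ 2 = ‖z‖ ^ 2 := by
  rw [← Complex.normSq_eq_norm_sq, Complex.normSq_apply]; ring

lemma tendsto_spinA_atTop (k : ℝ) : Tendsto (spinA k) atTop (𝓝 0) := by
  have h : Tendsto (fun s : ℝ => 2 / s * (Real.exp (Real.pi * (k ^ 2 / 2)) * √(2 * Real.pi)))
      atTop (𝓝 0) := by
    simpa using ((tendsto_const_nhds (x := (2 : ℝ))).div_atTop tendsto_id).mul_const
      (Real.exp (Real.pi * (k ^ 2 / 2)) * √(2 * Real.pi))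
  refine squeeze_zero_norm' ?_ h
  filter_upwards [eventually_gt_atTop 0] with s hs using norm_spinA_le k hs

lemma ofReal_mul_cpow {r : ℝ} (hr : 0 < r) {z : ℂ} (hz : z ≠ 0) (p : ℂ) :
    ((r : ℂ) * z) ^ p = (r : ℂ) ^ p * z ^ p := by
  have hr' : (r : ℂ) ≠ 0 := by exact_mod_cast hr.ne'
  rw [Complex.cpow_def_of_ne_zero (mul_ne_zero hr' hz), Complex.cpow_def_of_ne_zero hr',
    Complex.cpow_def_of_ne_zero hz, Complex.log_ofReal_mul hr hz, Complex.ofReal_log hr.le, add_mul,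
    Complex.exp_add]

lemma cylLine_eq_mul {s : ℝ} (hs : 0 < s) (y : ℝ) :
    cylLine s y = (s : ℂ) * cylLine 1 (s⁻¹ * y) := by
  have : (s : ℂ) ≠ 0 := by exact_mod_cast hs.ne'
  simp only [cylLine]; push_cast; field_simp

/-- The factor `s ^ p` can be pulled out, and it has modulus one for imaginary `p`. What remains has
a limit as `s → ∞`, although `cylIntegral p s` itself keeps rotating. -/
lemma norm_cylIntegral_eq {p : ℂ} (hp : p.re = 0) {s : ℝ} (hs : 0 < s) :
    ‖cylIntegral p s‖ =
      ‖∫ y, cylLine 1 (s⁻¹ * y) ^ p * (Real.exp (-(1 / 2) * y ^ 2) : ℂ)‖ := by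
  have : ∀ y, cylKernel p s y =
      (s : ℂ) ^ p * (cylLine 1 (s⁻¹ * y) ^ p * (Real.exp (-(1 / 2) * y ^ 2) : ℂ)) := fun y => by
    rw [cylKernel, cylLine_eq_mul hs, ofReal_mul_cpow hs
      (Complex.slitPlane_ne_zero (cylLine_mem_slitPlane one_pos _)), mul_assoc]
  simp_rw [cylIntegral, this]
  rw [integral_const_mul, norm_mul, Complex.norm_cpow_eq_rpow_re_of_pos hs, hp, Real.rpow_zero,
    one_mul]

lemma tendsto_norm_cylIntegral_atTop {p : ℂ} (hp : p.re = 0) :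
    Tendsto (fun s => ‖cylIntegral p s‖) atTop (𝓝 √(2 * Real.pi)) := by
  have h : Tendsto (fun s : ℝ => ∫ y, cylLine 1 (s⁻¹ * y) ^ p *
      (Real.exp (-(1 / 2) * y ^ 2) : ℂ)) atTop
      (𝓝 (∫ y : ℝ, (Real.exp (-(1 / 2) * y ^ 2) : ℂ))) := by
    refine tendsto_integral_filter_of_dominated_convergence
      (fun y => Real.exp (Real.pi * |p.im|) * Real.exp (-(1 / 2) * y ^ 2)) ?_ ?_
      (integrable_gauss_half _) ?_
    · refine Eventually.of_forall fun s => Measurable.aestronglyMeasurable ?_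
      unfold cylLine; fun_prop
    · refine Eventually.of_forall fun s => Eventually.of_forall fun y => ?_
      rw [norm_mul, Complex.norm_real, Real.norm_of_nonneg (Real.exp_pos _).le]
      exact mul_le_mul_of_nonneg_right (norm_cpow_le_of_re_eq_zero hp _) (Real.exp_pos _).le
    · refine Eventually.of_forall fun y => ?_
      have h1 : Tendsto (fun s : ℝ => cylLine 1 (s⁻¹ * y)) atTop (𝓝 1) := by
        have h2 : Continuous fun t : ℝ => cylLine 1 t := by unfold cylLine; fun_prop
        have h3 : Tendsto (fun s : ℝ => s⁻¹ * y) atTop (𝓝 0) := by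
          simpa using tendsto_inv_atTop_zero.mul_const y
        have := (h2.tendsto 0).comp h3
        rwa [show cylLine 1 0 = 1 by simp [cylLine]] at this
      have h4 := (h1.cpow tendsto_const_nhds (by simp) :
        Tendsto (fun s : ℝ => cylLine 1 (s⁻¹ * y) ^ p) atTop (𝓝 (1 ^ p)))
      have h6 := h4.mul_const (Real.exp (-(1 / 2) * y ^ 2) : ℂ)
      rwa [Complex.one_cpow, one_mul] at h6
  have h5 := h.norm
  rw [integral_complex_ofReal, integral_gauss_half, Complex.norm_real,
    Real.norm_of_nonneg (Real.sqrt_nonneg _)] at h5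
  refine h5.congr' ?_
  filter_upwards [eventually_gt_atTop 0] with s hs using (norm_cylIntegral_eq hp hs).symm

lemma spinMass_eq_norm (k s : ℝ) : spinMass k s = ‖spinB k s‖ ^ 2 + k ^ 2 * ‖spinA k s‖ ^ 2 := by
  rw [spinMass, norm_sq_eq_re_im, norm_sq_eq_re_im]

/-- The mass is conserved, so it equals its limit at infinity, where `|B|² → 2π` and `A → 0`. -/
lemma spinMass_eq (k : ℝ) {s : ℝ} (hs : 0 < s) : spinMass k s = 2 * Real.pi := by
  have h1 : Tendsto (spinMass k) atTop (𝓝 (2 * Real.pi)) := by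
    have := ((tendsto_norm_cylIntegral_atTop (cylExp_re k)).pow 2).add
      (((tendsto_spinA_atTop k).norm.pow 2).const_mul (k ^ 2))
    rw [Real.sq_sqrt (by positivity)] at this
    simp only [norm_zero, ne_eq, OfNat.ofNat_ne_zero, not_false_eq_true, zero_pow, mul_zero,
      add_zero] at this
    exact this.congr fun t => (spinMass_eq_norm k t).symm
  refine tendsto_nhds_unique (tendsto_const_nhds.congr' ?_) h1
  filter_upwards [eventually_gt_atTop 0] with t ht using
    eq_of_hasDerivAt_zero_Ioi (fun _ h => hasDerivAt_spinMass k h) hs ht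

lemma bloch_sq_add (k : ℝ) {s : ℝ} (hs : 0 < s) :
    blochX k s ^ 2 + blochY k s ^ 2 + blochZ k s ^ 2 = 1 := by
  have h := spinMass_eq k hs
  have : blochX k s ^ 2 + blochY k s ^ 2 + blochZ k s ^ 2 =
      ((2 * Real.pi)⁻¹ * spinMass k s) ^ 2 := by
    simp only [blochX, blochY, blochZ, spinMass]; ring
  rw [this, h, inv_mul_cancel₀ (by positivity), one_pow]

lemma blochX_eq (k : ℝ) {s : ℝ} (hs : 0 < s) :
    blochX k s = 1 - (2 * Real.pi)⁻¹ * (2 * k ^ 2 * ‖spinA k s‖ ^ 2) := by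
  have h := spinMass_eq k hs
  have h2 : (2 * Real.pi)⁻¹ * spinMass k s = 1 := by
    rw [h, inv_mul_cancel₀ (by positivity)]
  rw [← h2, ← norm_sq_eq_re_im]
  simp only [blochX, spinMass]; ring

/-- Eliminating `spinA` serves the limit `s → 0⁺`: the exponent of `spinA` has real part `-1`, so
its integrand has no integrable bound at `s = 0`, whereas that of `spinB` stays bounded. -/
lemma blochX_eq' (k : ℝ) {s : ℝ} (hs : 0 < s) :
    blochX k s = Real.pi⁻¹ * ‖spinB k s‖ ^ 2 - 1 := by
  have h := spinMass_eq k hs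
  have h2 : (2 * Real.pi)⁻¹ * spinMass k s = 1 := by
    rw [h, inv_mul_cancel₀ (by positivity)]
  rw [← h2, ← norm_sq_eq_re_im]
  simp only [blochX, spinMass, mul_inv]; ring

lemma tendsto_blochX_atTop (k : ℝ) : Tendsto (blochX k) atTop (𝓝 1) := by
  have := ((((tendsto_spinA_atTop k).norm.pow 2).const_mul (2 * k ^ 2)).const_mul
    (2 * Real.pi)⁻¹).const_sub 1
  simp only [norm_zero, ne_eq, OfNat.ofNat_ne_zero, not_false_eq_true, zero_pow, mul_zero,
      sub_zero] at this
  refine this.congr' ?_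
  filter_upwards [eventually_gt_atTop 0] with t ht using (blochX_eq k ht).symm

/-- The constant in the decay of the transversal components. -/
def blochConst (k : ℝ) : ℝ := 4 * |k| * Real.exp (Real.pi * k ^ 2)

lemma bloch_decay_aux (k : ℝ) {s : ℝ} (hs : 0 < s) :
    (2 * Real.pi)⁻¹ * (2 * |k| * (‖spinB k s‖ * ‖spinA k s‖)) ≤ blochConst k / s := by
  have h1 := mul_le_mul (norm_spinB_le k hs) (norm_spinA_le k hs) (norm_nonneg _) (by positivity)
  have e1 : Real.exp (Real.pi * k ^ 2) = Real.exp (Real.pi * (k ^ 2 / 2)) ^ 2 := by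
    rw [← Real.exp_nat_mul]; congr 1; push_cast; ring
  have e2 := Real.sq_sqrt (show 0 ≤ 2 * Real.pi by positivity)
  calc _ ≤ (2 * Real.pi)⁻¹ * (2 * |k| * (Real.exp (Real.pi * (k ^ 2 / 2)) * √(2 * Real.pi) *
        (2 / s * (Real.exp (Real.pi * (k ^ 2 / 2)) * √(2 * Real.pi))))) := by gcongr
    _ = (2 * Real.pi)⁻¹ * (√(2 * Real.pi) ^ 2) * (4 * |k| *
        Real.exp (Real.pi * (k ^ 2 / 2)) ^ 2 / s) := by ring
    _ = _ := by rw [e2, inv_mul_cancel₀ (by positivity), one_mul, ← e1]; rfl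

lemma abs_blochY_le (k : ℝ) {s : ℝ} (hs : 0 < s) : |blochY k s| ≤ blochConst k / s := by
  refine le_trans (le_of_eq_of_le (b := (2 * Real.pi)⁻¹ * (2 * |k| *
      |(spinB k s * (starRingEnd ℂ) (spinA k s)).im|)) ?_ ?_) (bloch_decay_aux k hs)
  · rw [blochY, abs_mul, abs_mul, abs_mul, abs_of_pos (show 0 < (2 * Real.pi)⁻¹ by positivity),
      abs_two, Complex.mul_im, Complex.conj_re, Complex.conj_im]
    congr 3; ring
  · have := Complex.abs_im_le_norm (spinB k s * (starRingEnd ℂ) (spinA k s))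
    rw [norm_mul, RCLike.norm_conj] at this
    gcongr

lemma abs_blochZ_le (k : ℝ) {s : ℝ} (hs : 0 < s) : |blochZ k s| ≤ blochConst k / s := by
  refine le_trans (le_of_eq_of_le (b := (2 * Real.pi)⁻¹ * (2 * |k| *
      |(spinB k s * (starRingEnd ℂ) (spinA k s)).re|)) ?_ ?_) (bloch_decay_aux k hs)
  · rw [blochZ, abs_mul, abs_mul, abs_mul, abs_of_pos (show 0 < (2 * Real.pi)⁻¹ by positivity),
      abs_two, Complex.mul_re, Complex.conj_re, Complex.conj_im]
    congr 3; ring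
  · have := Complex.abs_re_le_norm (spinB k s * (starRingEnd ℂ) (spinA k s))
    rw [norm_mul, RCLike.norm_conj] at this
    gcongr

lemma abs_blochX_le_one (k : ℝ) {s : ℝ} (hs : 0 < s) : |blochX k s| ≤ 1 := by
  have := bloch_sq_add k hs
  rw [abs_le_one_iff_mul_self_le_one]
  nlinarith [sq_nonneg (blochY k s), sq_nonneg (blochZ k s)]

lemma abs_blochY_le_one (k : ℝ) {s : ℝ} (hs : 0 < s) : |blochY k s| ≤ 1 := by
  have := bloch_sq_add k hs
  rw [abs_le_one_iff_mul_self_le_one]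
  nlinarith [sq_nonneg (blochX k s), sq_nonneg (blochZ k s)]

lemma abs_blochZ_le_one (k : ℝ) {s : ℝ} (hs : 0 < s) : |blochZ k s| ≤ 1 := by
  have := bloch_sq_add k hs
  rw [abs_le_one_iff_mul_self_le_one]
  nlinarith [sq_nonneg (blochX k s), sq_nonneg (blochY k s)]

/-! ### Continuity in the curvature -/

lemma continuous_cylIntegral_comp {q : ℝ → ℂ} (hq : Continuous q) {r : ℝ} (hr : r ≤ 0)
    (hre : ∀ k, (q k).re = r) {s : ℝ} (hs : 0 < s) : Continuous fun k => cylIntegral (q k) s := by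
  refine continuous_iff_continuousAt.2 fun k₀ => ?_
  have hev : ∀ᶠ k in 𝓝 k₀, |(q k).im| < |(q k₀).im| + 1 := by
    have : Continuous fun k => |(q k).im| := (Complex.continuous_im.comp hq).abs
    exact this.continuousAt.eventually_lt_const (by simp)
  refine continuousAt_of_dominated (bound := fun y => (s / 2) ^ r *
    Real.exp (Real.pi * (|(q k₀).im| + 1)) * Real.exp (-(1 / 2) * y ^ 2))
    (Eventually.of_forall fun k => (measurable_cylKernel _ s).aestronglyMeasurable) ?_
    (integrable_gauss_half _) ?_
  · filter_upwards [hev] with k hk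
    refine Eventually.of_forall fun y => ?_
    refine (norm_cylKernel_le (by rw [hre]; exact hr) hs le_rfl y).trans ?_
    rw [hre]
    gcongr
  · refine Eventually.of_forall fun y => ?_
    have h := Complex.slitPlane_ne_zero (cylLine_mem_slitPlane hs y)
    exact (((continuousAt_const_cpow h).comp hq.continuousAt).mul continuousAt_const)

lemma continuous_cylExp : Continuous cylExp := by unfold cylExp; fun_prop

lemma continuous_spinB {s : ℝ} (hs : 0 < s) : Continuous fun k => spinB k s :=
  continuous_cylIntegral_comp continuous_cylExp le_rfl cylExp_re hs

lemma continuous_spinA {s : ℝ} (hs : 0 < s) : Continuous fun k => spinA k s :=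
  continuous_cylIntegral_comp (q := fun k => cylExp k - 1) (continuous_cylExp.sub continuous_const)
    (r := -1) (by norm_num) (fun k => by simp [cylExp_re]) hs

lemma continuous_blochX {s : ℝ} (hs : 0 < s) : Continuous fun k => blochX k s := by
  have h1 := Complex.continuous_re.comp (continuous_spinB hs)
  have h2 := Complex.continuous_im.comp (continuous_spinB hs)
  have h3 := Complex.continuous_re.comp (continuous_spinA hs)
  have h4 := Complex.continuous_im.comp (continuous_spinA hs)
  simp only [Function.comp_def] at h1 h2 h3 h4
  unfold blochX; fun_prop

lemma continuous_blochY {s : ℝ} (hs : 0 < s) : Continuous fun k => blochY k s := by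
  have h1 := Complex.continuous_re.comp (continuous_spinB hs)
  have h2 := Complex.continuous_im.comp (continuous_spinB hs)
  have h3 := Complex.continuous_re.comp (continuous_spinA hs)
  have h4 := Complex.continuous_im.comp (continuous_spinA hs)
  simp only [Function.comp_def] at h1 h2 h3 h4
  unfold blochY; fun_prop

/-! ### The value at the origin -/

lemma tendsto_cylIntegral_zero {p : ℂ} (hp : p.re = 0) :
    Tendsto (cylIntegral p) (𝓝[>] 0) (𝓝 (cylIntegral p 0)) := by
  refine tendsto_integral_filter_of_dominated_convergence
      (fun y => Real.exp (Real.pi * |p.im|) * Real.exp (-(1 / 2) * y ^ 2)) ?_ ?_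
      (integrable_gauss_half _) ?_
  · exact Eventually.of_forall fun s => (measurable_cylKernel p s).aestronglyMeasurable
  · refine Eventually.of_forall fun s => Eventually.of_forall fun y => ?_
    rw [norm_cylKernel]
    exact mul_le_mul_of_nonneg_right (norm_cpow_le_of_re_eq_zero hp _) (Real.exp_pos _).le
  · have hne : ∀ᵐ y : ℝ, y ≠ 0 := by simp [ae_iff]
    filter_upwards [hne] with y hy
    have h1 : ContinuousAt (fun s => cylLine s y) 0 := by unfold cylLine; fun_prop
    have h2 := (h1.cpow continuousAt_const (cylLine_mem_slitPlane_of_ne hy 0) :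
      ContinuousAt (fun s => cylLine s y ^ p) 0)
    exact ((h2.mul continuousAt_const).tendsto).mono_left nhdsWithin_le_nhds

lemma one_sub_I_cpow (p : ℂ) : (1 - Complex.I) ^ p =
    (√2 : ℂ) ^ p * Complex.exp (-(Real.pi / 4) * Complex.I * p) := by
  have h2 : (0 : ℝ) < √2 := by positivity
  have e : (1 - Complex.I : ℂ) = ((√2 : ℝ) : ℂ) * Complex.exp (-(Real.pi / 4 : ℝ) * Complex.I) := by
    rw [Complex.exp_mul_I, Complex.cos_neg, Complex.sin_neg, ← Complex.ofReal_cos,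
      ← Complex.ofReal_sin, Real.cos_pi_div_four, Real.sin_pi_div_four]
    have : ((√2 : ℝ) : ℂ) * ((√2 : ℝ) : ℂ) = 2 := by
      exact_mod_cast Real.mul_self_sqrt (by norm_num : (0 : ℝ) ≤ 2)
    push_cast
    linear_combination (-(1 / 2) + Complex.I / 2) * this
  rw [e, ofReal_mul_cpow h2 (Complex.exp_ne_zero _)]
  congr 1
  rw [Complex.cpow_def_of_ne_zero (Complex.exp_ne_zero _), Complex.log_exp]
  · push_cast; rfl
  · simp; linarith [Real.pi_pos]
  · simp; linarith [Real.pi_pos]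

/-- The principal argument is `3π/4` here against `-π/4` for `1 - i`. For imaginary `p` the two
halves of the line therefore carry different real weights. -/
lemma neg_one_sub_I_cpow (p : ℂ) : (-(1 - Complex.I)) ^ p =
    (√2 : ℂ) ^ p * Complex.exp (3 * (Real.pi / 4) * Complex.I * p) := by
  have h2 : (0 : ℝ) < √2 := by positivity
  have e : (-(1 - Complex.I) : ℂ) =
      ((√2 : ℝ) : ℂ) * Complex.exp ((Real.pi - Real.pi / 4 : ℝ) * Complex.I) := by
    rw [Complex.exp_mul_I, ← Complex.ofReal_cos,
      ← Complex.ofReal_sin, Real.cos_pi_sub, Real.sin_pi_sub,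
      Real.cos_pi_div_four, Real.sin_pi_div_four]
    have : ((√2 : ℝ) : ℂ) * ((√2 : ℝ) : ℂ) = 2 := by
      exact_mod_cast Real.mul_self_sqrt (by norm_num : (0 : ℝ) ≤ 2)
    push_cast
    linear_combination ((1 / 2) - Complex.I / 2) * this
  rw [e, ofReal_mul_cpow h2 (Complex.exp_ne_zero _)]
  congr 1
  rw [Complex.cpow_def_of_ne_zero (Complex.exp_ne_zero _), Complex.log_exp]
  · push_cast; congr 1; ring
  · simp; linarith [Real.pi_pos]
  · simp; linarith [Real.pi_pos]

/-- The Mellin transform of the Gaussian. -/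
def gaussMellin (p : ℂ) : ℂ :=
  ∫ y in Set.Ioi (0 : ℝ), (y : ℂ) ^ p * (Real.exp (-(1 / 2) * y ^ 2) : ℂ)

lemma gaussMellin_eq {p : ℂ} (hp : p.re = 0) :
    gaussMellin p = 1 / 2 * (2 ^ ((p + 1) / 2) * Complex.Gamma ((p + 1) / 2)) := by
  have h1 := mellin_comp_rpow (fun t : ℝ => Complex.exp (-((1 / 2 : ℝ) * (t : ℂ)))) (p + 1) 2
  have h2 := Complex.integral_cpow_mul_exp_neg_mul_Ioi (a := (p + 1) / 2) (r := 1 / 2)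
    (by simp [hp]) (by norm_num)
  simp only [mellin, smul_eq_mul] at h1
  have h3 : gaussMellin p = ∫ t in Set.Ioi (0 : ℝ), (t : ℂ) ^ (p + 1 - 1) *
      Complex.exp (-((1 / 2 : ℝ) * ((t ^ (2 : ℝ) : ℝ) : ℂ))) := by
    unfold gaussMellin
    congr 1; ext t
    rw [add_sub_cancel_right, Real.rpow_two]
    push_cast; congr 2; ring
  rw [h3, h1]
  simp only [Complex.ofReal_ofNat]
  rw [h2]
  simp

/-- For `p = i v` the numbers `(p + 1) / 2` and `1 - (p + 1) / 2` are conjugate, so the reflection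
formula yields `|Γ|²`. -/
lemma norm_sq_gaussMellin (v : ℝ) :
    ‖gaussMellin (v * Complex.I)‖ ^ 2 = Real.pi / (2 * Real.cosh (Real.pi * v / 2)) := by
  rw [gaussMellin_eq (by simp), norm_mul, norm_mul]
  have e1 : ‖(2 : ℂ) ^ (((v : ℂ) * Complex.I + 1) / 2)‖ = √2 := by
    have := Complex.norm_cpow_eq_rpow_re_of_pos (x := 2) (by norm_num)
      (((v : ℂ) * Complex.I + 1) / 2)
    rw [Complex.ofReal_ofNat] at this
    rw [this, Real.sqrt_eq_rpow]; simp
  have e2 : ‖Complex.Gamma (((v : ℂ) * Complex.I + 1) / 2)‖ ^ 2 =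
      Real.pi / Real.cosh (Real.pi * v / 2) := by
    have h := Complex.Gamma_mul_Gamma_one_sub (((v : ℂ) * Complex.I + 1) / 2)
    have hc : 1 - ((v : ℂ) * Complex.I + 1) / 2 =
        (starRingEnd ℂ) (((v : ℂ) * Complex.I + 1) / 2) := by
      rw [map_div₀, map_add, map_mul, map_one, map_ofNat, Complex.conj_I, Complex.conj_ofReal]
      ring
    rw [hc, Complex.Gamma_conj, Complex.mul_conj, Complex.normSq_eq_norm_sq] at h
    have hs : Complex.sin (Real.pi * (((v : ℂ) * Complex.I + 1) / 2)) =
        (Real.cosh (Real.pi * v / 2) : ℂ) := by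
      rw [show (Real.pi : ℂ) * (((v : ℂ) * Complex.I + 1) / 2) =
        (Real.pi * v / 2 : ℂ) * Complex.I + Real.pi / 2 by ring, Complex.sin_add_pi_div_two,
        Complex.cos_mul_I]
      push_cast; rfl
    rw [hs] at h
    exact_mod_cast h
  rw [e1, mul_pow, mul_pow, e2, Real.sq_sqrt (by norm_num)]
  have : (0 : ℝ) < Real.cosh (Real.pi * v / 2) := Real.cosh_pos _
  norm_num
  field_simp
  norm_num

lemma integrableOn_cylKernel_zero {p : ℂ} (hp : p.re = 0) (S : Set ℝ) :
    IntegrableOn (cylKernel p 0) S := by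
  refine ((integrable_gauss_half (Real.exp (Real.pi * |p.im|))).mono'
    (measurable_cylKernel p 0).aestronglyMeasurable
    (Eventually.of_forall fun y => ?_)).integrableOn
  rw [norm_cylKernel]
  exact mul_le_mul_of_nonneg_right (norm_cpow_le_of_re_eq_zero hp _) (Real.exp_pos _).le

lemma one_sub_I_ne_zero : (1 - Complex.I : ℂ) ≠ 0 := fun h => by
  have := congrArg Complex.re h; simp at this

lemma cylIntegral_zero_eq {p : ℂ} (hp : p.re = 0) :
    cylIntegral p 0 = ((1 - Complex.I) ^ p + (-(1 - Complex.I)) ^ p) * gaussMellin p := by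
  have hpos : ∫ y in Set.Ioi (0 : ℝ), cylKernel p 0 y = (1 - Complex.I) ^ p * gaussMellin p := by
    rw [gaussMellin, ← integral_const_mul]
    refine setIntegral_congr_fun measurableSet_Ioi fun y hy => ?_
    simp only [cylKernel, cylLine, Complex.ofReal_zero, zero_add]
    rw [mul_comm (1 - Complex.I), ofReal_mul_cpow hy one_sub_I_ne_zero]; ring
  have hneg : ∫ y in Set.Iic (0 : ℝ), cylKernel p 0 y = (-(1 - Complex.I)) ^ p * gaussMellin p := by
    have h := integral_comp_neg_Iic 0 fun y => cylKernel p 0 (-y)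
    simp only [neg_neg, neg_zero] at h
    rw [h, gaussMellin, ← integral_const_mul]
    refine setIntegral_congr_fun measurableSet_Ioi fun y hy => ?_
    simp only [cylKernel, cylLine, Complex.ofReal_zero, zero_add, Complex.ofReal_neg, neg_sq]
    rw [show (1 - Complex.I) * -(y : ℂ) = (y : ℂ) * -(1 - Complex.I) by ring,
      ofReal_mul_cpow hy (neg_ne_zero.2 one_sub_I_ne_zero)]; ring
  rw [cylIntegral, ← intervalIntegral.integral_Iic_add_Ioi (integrableOn_cylKernel_zero hp _)
    (integrableOn_cylKernel_zero hp _), hpos, hneg]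
  ring

lemma norm_sq_cylIntegral_zero (v : ℝ) :
    ‖cylIntegral (v * Complex.I) 0‖ ^ 2 = Real.pi * (1 + Real.exp (-(Real.pi * v))) := by
  have hre : ((v : ℂ) * Complex.I).re = 0 := by simp
  rw [cylIntegral_zero_eq hre, norm_mul, mul_pow, norm_sq_gaussMellin, one_sub_I_cpow,
    neg_one_sub_I_cpow, ← mul_add, norm_mul, mul_pow]
  have e0 : ‖(√2 : ℂ) ^ ((v : ℂ) * Complex.I)‖ = 1 := by
    rw [Complex.norm_cpow_eq_rpow_re_of_pos (by positivity), hre, Real.rpow_zero]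
  have e1 : Complex.exp (-(Real.pi / 4) * Complex.I * (v * Complex.I)) +
      Complex.exp (3 * (Real.pi / 4) * Complex.I * (v * Complex.I)) =
      ((Real.exp (-(Real.pi * v / 4)) * (2 * Real.cosh (Real.pi * v / 2)) : ℝ) : ℂ) := by
    rw [Real.cosh_eq]
    push_cast
    rw [mul_div_cancel₀ _ (two_ne_zero' ℂ), mul_add, ← Complex.exp_add, ← Complex.exp_add]
    congr 2
    · linear_combination (-(Real.pi / 4) * v : ℂ) * Complex.I_sq
    · linear_combination (3 * (Real.pi / 4) * v : ℂ) * Complex.I_sq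
  rw [e0, e1, Complex.norm_real, Real.norm_eq_abs, sq_abs]
  have hc : (0 : ℝ) < Real.cosh (Real.pi * v / 2) := Real.cosh_pos _
  have e2 : Real.exp (-(Real.pi * v / 4)) ^ 2 * (2 * Real.cosh (Real.pi * v / 2)) =
      1 + Real.exp (-(Real.pi * v)) := by
    rw [Real.cosh_eq, mul_div_cancel₀ _ (two_ne_zero' ℝ), ← Real.exp_nat_mul, mul_add,
      ← Real.exp_add, ← Real.exp_add, ← Real.exp_zero]
    congr 2 <;> push_cast <;> ring
  rw [← e2]
  field_simp

lemma tendsto_blochX_zero (k : ℝ) :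
    Tendsto (blochX k) (𝓝[>] 0) (𝓝 (Real.exp (-(Real.pi * (k ^ 2 / 2))))) := by
  have h := ((((tendsto_cylIntegral_zero (cylExp_re k)).norm.pow 2).const_mul
    Real.pi⁻¹).sub_const 1)
  rw [cylExp, norm_sq_cylIntegral_zero, inv_mul_cancel_left₀ Real.pi_pos.ne',
    add_sub_cancel_left] at h
  refine h.congr' ?_
  filter_upwards [self_mem_nhdsWithin] with s hs using (blochX_eq' k hs).symm

/-! ### Linear algebra of the scalar Frenet system -/

namespace FrenetOn

variable {k c : ℝ} {S : Set ℝ} {x y z x' y' z' : ℝ → ℝ}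

lemma mono {S' : Set ℝ} (h : FrenetOn k S x y z) (hS : S' ⊆ S) : FrenetOn k S' x y z :=
  ⟨fun s hs => h.dx s (hS hs), fun s hs => h.dy s (hS hs), fun s hs => h.dz s (hS hs)⟩

lemma sub (h : FrenetOn k S x y z) (h' : FrenetOn k S x' y' z') :
    FrenetOn k S (fun s => x s - x' s) (fun s => y s - y' s) (fun s => z s - z' s) where
  dx s hs := ((h.dx s hs).sub (h'.dx s hs)).congr_deriv (by ring)
  dy s hs := ((h.dy s hs).sub (h'.dy s hs)).congr_deriv (by ring)
  dz s hs := ((h.dz s hs).sub (h'.dz s hs)).congr_deriv (by ring)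

lemma add (h : FrenetOn k S x y z) (h' : FrenetOn k S x' y' z') :
    FrenetOn k S (fun s => x s + x' s) (fun s => y s + y' s) (fun s => z s + z' s) where
  dx s hs := ((h.dx s hs).add (h'.dx s hs)).congr_deriv (by ring)
  dy s hs := ((h.dy s hs).add (h'.dy s hs)).congr_deriv (by ring)
  dz s hs := ((h.dz s hs).add (h'.dz s hs)).congr_deriv (by ring)

lemma const_mul (a : ℝ) (h : FrenetOn k S x y z) :
    FrenetOn k S (fun s => a * x s) (fun s => a * y s) (fun s => a * z s) where
  dx s hs := ((h.dx s hs).const_mul a).congr_deriv (by ring)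
  dy s hs := ((h.dy s hs).const_mul a).congr_deriv (by ring)
  dz s hs := ((h.dz s hs).const_mul a).congr_deriv (by ring)

lemma crossProd (h : FrenetOn k S x y z) (h' : FrenetOn k S x' y' z') :
    FrenetOn k S (fun s => y s * z' s - z s * y' s) (fun s => z s * x' s - x s * z' s)
      (fun s => x s * y' s - y s * x' s) where
  dx s hs := (((h.dy s hs).mul (h'.dz s hs)).sub ((h.dz s hs).mul (h'.dy s hs))).congr_deriv
    (by ring)
  dy s hs := (((h.dz s hs).mul (h'.dx s hs)).sub ((h.dx s hs).mul (h'.dz s hs))).congr_deriv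
    (by ring)
  dz s hs := (((h.dx s hs).mul (h'.dy s hs)).sub ((h.dy s hs).mul (h'.dx s hs))).congr_deriv
    (by ring)

/-- The reflection `s ↦ -s` acts on solutions. -/
lemma reflect (h : FrenetOn k Set.univ x y z) :
    FrenetOn k Set.univ (fun s => x (-s)) (fun s => -y (-s)) (fun s => -z (-s)) where
  dx s _ := ((h.dx (-s) trivial).comp s (hasDerivAt_neg s)).congr_deriv (by ring)
  dy s _ := ((h.dy (-s) trivial).comp s (hasDerivAt_neg s)).neg.congr_deriv (by ring)
  dz s _ := ((h.dz (-s) trivial).comp s (hasDerivAt_neg s)).neg.congr_deriv (by ring)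

/-- Both solutions have the same torsion, so its contributions cancel and only the difference of the
curvatures survives. -/
lemma hasDerivAt_pairing (h : FrenetOn k S x y z) (h' : FrenetOn c S x' y' z') {s : ℝ}
    (hs : s ∈ S) : HasDerivAt (fun s => x s * x' s + y s * y' s + z s * z' s)
      ((k - c) * (y s * x' s - x s * y' s)) s :=
  ((((h.dx s hs).mul (h'.dx s hs)).add ((h.dy s hs).mul (h'.dy s hs))).add
    ((h.dz s hs).mul (h'.dz s hs))).congr_deriv (by ring)

lemma pairing_const (h : FrenetOn k Set.univ x y z) (h' : FrenetOn k Set.univ x' y' z') (s t : ℝ) :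
    x s * x' s + y s * y' s + z s * z' s = x t * x' t + y t * y' t + z t * z' t := by
  have hd : ∀ s, HasDerivAt (fun s => x s * x' s + y s * y' s + z s * z' s) 0 s := fun s =>
    (h.hasDerivAt_pairing h' (Set.mem_univ s)).congr_deriv (by ring)
  exact is_const_of_deriv_eq_zero (fun s => (hd s).differentiableAt) (fun s => (hd s).deriv) s t

lemma pairing_const_Ioi (h : FrenetOn k (Set.Ioi 0) x y z) (h' : FrenetOn k (Set.Ioi 0) x' y' z')
    {s t : ℝ} (hs : 0 < s) (ht : 0 < t) :
    x s * x' s + y s * y' s + z s * z' s = x t * x' t + y t * y' t + z t * z' t :=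
  eq_of_hasDerivAt_zero_Ioi (f := fun s => x s * x' s + y s * y' s + z s * z' s)
    (fun _ hs => (h.hasDerivAt_pairing h' hs).congr_deriv (by ring)) hs ht

/-- Uniqueness needs no ODE theory: the squared norm of the difference is a constant pairing. -/
lemma eq_of_eq_zero (h : FrenetOn k Set.univ x y z) (h' : FrenetOn k Set.univ x' y' z')
    (hx : x 0 = x' 0) (hy : y 0 = y' 0) (hz : z 0 = z' 0) (s : ℝ) :
    x s = x' s ∧ y s = y' s ∧ z s = z' s := by
  have hd := (h.sub h').pairing_const (h.sub h') s 0
  simp only [hx, hy, hz, sub_self, mul_zero, add_zero] at hd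
  refine ⟨?_, ?_, ?_⟩ <;> refine sub_eq_zero.1 (pow_eq_zero_iff two_ne_zero |>.1 ?_) <;>
  nlinarith [sq_nonneg (x s - x' s), sq_nonneg (y s - y' s), sq_nonneg (z s - z' s)]

lemma eq_zero_of_tendsto (h : FrenetOn k (Set.Ioi 0) x y z) (hx : Tendsto x (𝓝[>] 0) (𝓝 0))
    (hy : Tendsto y (𝓝[>] 0) (𝓝 0)) (hz : Tendsto z (𝓝[>] 0) (𝓝 0)) {s : ℝ} (hs : 0 < s) :
    x s = 0 ∧ y s = 0 ∧ z s = 0 := by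
  have hl : Tendsto (fun t => x t * x t + y t * y t + z t * z t) (𝓝[>] 0) (𝓝 0) := by
    simpa using ((hx.mul hx).add (hy.mul hy)).add (hz.mul hz)
  have hd : x s * x s + y s * y s + z s * z s = 0 := by
    refine tendsto_nhds_unique (tendsto_const_nhds.congr' ?_) hl
    filter_upwards [self_mem_nhdsWithin] with t ht using h.pairing_const_Ioi h hs ht
  refine ⟨?_, ?_, ?_⟩ <;> refine (pow_eq_zero_iff two_ne_zero |>.1 ?_) <;>
  nlinarith [sq_nonneg (x s), sq_nonneg (y s), sq_nonneg (z s)]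

end FrenetOn

/-! ### The frame at time `1` and its limit tangent. -/

/-- The rows of a Frenet frame of the one-corner solution at time `1`. -/
structure FrameRows (c : ℝ) (T n b : Fin 3 → ℝ → ℝ) : Prop where
  frenet : ∀ i, FrenetOn c Set.univ (T i) (n i) (b i)
  T_zero : ∀ i, T i 0 = if i = 0 then 1 else 0
  n_zero : ∀ i, n i 0 = if i = 1 then 1 else 0
  b_zero : ∀ i, b i 0 = if i = 2 then 1 else 0

/-- The limit tangent, as pairing of the frame with the explicit Frenet solution. -/
def limitTangent (c : ℝ) (T n b : Fin 3 → ℝ → ℝ) (i : Fin 3) : ℝ :=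
  blochX c 1 * T i 1 + blochY c 1 * n i 1 + blochZ c 1 * b i 1

namespace FrameRows

variable {c : ℝ} {T n b : Fin 3 → ℝ → ℝ}

lemma sq_add (h : FrameRows c T n b) (i : Fin 3) (s : ℝ) :
    T i s ^ 2 + n i s ^ 2 + b i s ^ 2 = 1 := by
  have h1 := (h.frenet i).pairing_const (h.frenet i) s 0
  rw [h.T_zero, h.n_zero, h.b_zero] at h1
  rw [pow_two, pow_two, pow_two, h1]
  fin_cases i <;> simp

lemma abs_T_le (h : FrameRows c T n b) (i : Fin 3) (s : ℝ) : |T i s| ≤ 1 := by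
  rw [abs_le_one_iff_mul_self_le_one]
  nlinarith [h.sq_add i s, sq_nonneg (n i s), sq_nonneg (b i s)]

lemma abs_n_le (h : FrameRows c T n b) (i : Fin 3) (s : ℝ) : |n i s| ≤ 1 := by
  rw [abs_le_one_iff_mul_self_le_one]
  nlinarith [h.sq_add i s, sq_nonneg (T i s), sq_nonneg (b i s)]

lemma abs_b_le (h : FrameRows c T n b) (i : Fin 3) (s : ℝ) : |b i s| ≤ 1 := by
  rw [abs_le_one_iff_mul_self_le_one]
  nlinarith [h.sq_add i s, sq_nonneg (T i s), sq_nonneg (n i s)]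

lemma continuous_T (h : FrameRows c T n b) (i : Fin 3) : Continuous (T i) :=
  continuous_iff_continuousAt.2 fun s => ((h.frenet i).dx s trivial).continuousAt

lemma continuous_n (h : FrameRows c T n b) (i : Fin 3) : Continuous (n i) :=
  continuous_iff_continuousAt.2 fun s => ((h.frenet i).dy s trivial).continuousAt

lemma continuous_b (h : FrameRows c T n b) (i : Fin 3) : Continuous (b i) :=
  continuous_iff_continuousAt.2 fun s => ((h.frenet i).dz s trivial).continuousAt

lemma tendsto_T_zero (h : FrameRows c T n b) (i : Fin 3) :
    Tendsto (T i) (𝓝[>] 0) (𝓝 (if i = 0 then 1 else 0)) := by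
  have := ((h.continuous_T i).tendsto 0).mono_left (nhdsWithin_le_nhds (s := Set.Ioi 0))
  rwa [h.T_zero] at this

lemma tendsto_n_zero (h : FrameRows c T n b) (i : Fin 3) :
    Tendsto (n i) (𝓝[>] 0) (𝓝 (if i = 1 then 1 else 0)) := by
  have := ((h.continuous_n i).tendsto 0).mono_left (nhdsWithin_le_nhds (s := Set.Ioi 0))
  rwa [h.n_zero] at this

lemma tendsto_b_zero (h : FrameRows c T n b) (i : Fin 3) :
    Tendsto (b i) (𝓝[>] 0) (𝓝 (if i = 2 then 1 else 0)) := by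
  have := ((h.continuous_b i).tendsto 0).mono_left (nhdsWithin_le_nhds (s := Set.Ioi 0))
  rwa [h.b_zero] at this

end FrameRows

lemma tendsto_zero_mul_of_abs_le_one {l : Filter ℝ} {f g : ℝ → ℝ} (hg : Tendsto g l (𝓝 0))
    (hf : ∀ᶠ s in l, |f s| ≤ 1) : Tendsto (fun s => f s * g s) l (𝓝 0) := by
  refine squeeze_zero_norm' ?_ (by simpa using hg.norm)
  filter_upwards [hf] with s hs
  rw [norm_mul]
  exact mul_le_of_le_one_left (norm_nonneg _) hs

lemma tendsto_blochY_atTop (k : ℝ) : Tendsto (blochY k) atTop (𝓝 0) := by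
  refine squeeze_zero_norm' ?_ ((tendsto_const_nhds (x := blochConst k)).div_atTop tendsto_id)
  filter_upwards [eventually_gt_atTop 0] with s hs using abs_blochY_le k hs

lemma tendsto_blochZ_atTop (k : ℝ) : Tendsto (blochZ k) atTop (𝓝 0) := by
  refine squeeze_zero_norm' ?_ ((tendsto_const_nhds (x := blochConst k)).div_atTop tendsto_id)
  filter_upwards [eventually_gt_atTop 0] with s hs using abs_blochZ_le k hs

namespace FrameRows

variable {c : ℝ} {T n b : Fin 3 → ℝ → ℝ}

/-- With equal curvatures the pairing is constant, so the evaluation point `1` in `limitTangent` is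
immaterial. -/
lemma pairing_eq (h : FrameRows c T n b) (i : Fin 3) {s : ℝ} (hs : 0 < s) :
    blochX c s * T i s + blochY c s * n i s + blochZ c s * b i s = limitTangent c T n b i :=
  (frenetOn_bloch c).pairing_const_Ioi ((h.frenet i).mono (Set.subset_univ _)) hs one_pos

/-- The pairing of a frame row with an explicit solution of any curvature tends at infinity to the
limit of the tangent component. -/
lemma tendsto_pairing_sub (h : FrameRows c T n b) (i : Fin 3) (k : ℝ) :
    Tendsto (fun s => blochX k s * T i s + blochY k s * n i s + blochZ k s * b i s - T i s)
      atTop (𝓝 0) := by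
  have hx : Tendsto (fun s => blochX k s - 1) atTop (𝓝 0) := by
    simpa using (tendsto_blochX_atTop k).sub_const 1
  have h1 := tendsto_zero_mul_of_abs_le_one hx (Eventually.of_forall (h.abs_T_le i))
  have h2 := tendsto_zero_mul_of_abs_le_one (tendsto_blochY_atTop k)
    (Eventually.of_forall (h.abs_n_le i))
  have h3 := tendsto_zero_mul_of_abs_le_one (tendsto_blochZ_atTop k)
    (Eventually.of_forall (h.abs_b_le i))
  have h4 := (h1.add h2).add h3
  rw [add_zero, add_zero] at h4
  exact h4.congr fun s => by ring

lemma tendsto_T_atTop (h : FrameRows c T n b) (i : Fin 3) :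
    Tendsto (T i) atTop (𝓝 (limitTangent c T n b i)) := by
  have h1 := (h.tendsto_pairing_sub i c).const_sub (limitTangent c T n b i)
  rw [sub_zero] at h1
  refine h1.congr' ?_
  filter_upwards [eventually_gt_atTop 0] with s hs
  rw [h.pairing_eq i hs]; ring

lemma tendsto_pairing_atTop (h : FrameRows c T n b) (i : Fin 3) (k : ℝ) :
    Tendsto (fun s => blochX k s * T i s + blochY k s * n i s + blochZ k s * b i s)
      atTop (𝓝 (limitTangent c T n b i)) := by
  have := (h.tendsto_pairing_sub i k).add (h.tendsto_T_atTop i)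
  rw [zero_add] at this
  exact this.congr fun s => by ring

/-- Near the origin, pairing a solution of norm `≤ 1` with the frame recovers the solution. -/
lemma tendsto_pairing_zero (h : FrameRows c T n b) (i : Fin 3) (k : ℝ) :
    Tendsto (fun s => (blochX k s * T i s + blochY k s * n i s + blochZ k s * b i s) -
      (blochX k s * (if i = 0 then 1 else 0) + blochY k s * (if i = 1 then 1 else 0) +
        blochZ k s * (if i = 2 then 1 else 0))) (𝓝[>] 0) (𝓝 0) := by
  have h1 := tendsto_zero_mul_of_abs_le_one (f := blochX k)
    (tendsto_sub_nhds_zero_iff.2 (h.tendsto_T_zero i))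
    (by filter_upwards [self_mem_nhdsWithin] with s hs using abs_blochX_le_one k hs)
  have h2 := tendsto_zero_mul_of_abs_le_one (f := blochY k)
    (tendsto_sub_nhds_zero_iff.2 (h.tendsto_n_zero i))
    (by filter_upwards [self_mem_nhdsWithin] with s hs using abs_blochY_le_one k hs)
  have h3 := tendsto_zero_mul_of_abs_le_one (f := blochZ k)
    (tendsto_sub_nhds_zero_iff.2 (h.tendsto_b_zero i))
    (by filter_upwards [self_mem_nhdsWithin] with s hs using abs_blochZ_le_one k hs)
  have h4 := (h1.add h2).add h3
  rw [add_zero, add_zero] at h4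
  exact h4.congr fun s => by ring

/-- The constant pairing is read at both ends: at infinity it is the limit of `T i`, at `0⁺` it is
the `i`-th component of the explicit solution, because the frame is the identity there. So `A⁺` is
the value of the explicit solution at the origin. -/
lemma tendsto_bloch_zero (h : FrameRows c T n b) (i : Fin 3) :
    Tendsto (fun s => blochX c s * (if i = 0 then 1 else 0) +
      blochY c s * (if i = 1 then 1 else 0) + blochZ c s * (if i = 2 then 1 else 0)) (𝓝[>] 0)
      (𝓝 (limitTangent c T n b i)) := by
  have := (h.tendsto_pairing_zero i c).const_sub (limitTangent c T n b i)
  rw [sub_zero] at this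
  refine this.congr' ?_
  filter_upwards [self_mem_nhdsWithin] with s hs
  rw [h.pairing_eq i hs]; ring

lemma tendsto_blochX_limitTangent (h : FrameRows c T n b) :
    Tendsto (blochX c) (𝓝[>] 0) (𝓝 (limitTangent c T n b 0)) := by
  simpa using h.tendsto_bloch_zero 0

lemma tendsto_blochY_limitTangent (h : FrameRows c T n b) :
    Tendsto (blochY c) (𝓝[>] 0) (𝓝 (limitTangent c T n b 1)) := by
  simpa using h.tendsto_bloch_zero 1

lemma tendsto_blochZ_limitTangent (h : FrameRows c T n b) :
    Tendsto (blochZ c) (𝓝[>] 0) (𝓝 (limitTangent c T n b 2)) := by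
  simpa using h.tendsto_bloch_zero 2

lemma limitTangent_zero (h : FrameRows c T n b) :
    limitTangent c T n b 0 = Real.exp (-(Real.pi * (c ^ 2 / 2))) :=
  tendsto_nhds_unique h.tendsto_blochX_limitTangent (tendsto_blochX_zero c)

lemma limitTangent_sq (h : FrameRows c T n b) :
    limitTangent c T n b 0 ^ 2 + limitTangent c T n b 1 ^ 2 + limitTangent c T n b 2 ^ 2 = 1 := by
  have h1 := ((h.tendsto_blochX_limitTangent.pow 2).add (h.tendsto_blochY_limitTangent.pow 2)).add
    (h.tendsto_blochZ_limitTangent.pow 2)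
  refine tendsto_nhds_unique h1 (tendsto_const_nhds.congr' ?_)
  filter_upwards [self_mem_nhdsWithin] with s hs using (bloch_sq_add c hs).symm

lemma frenet_sum (h : FrameRows c T n b) (a : Fin 3 → ℝ) :
    FrenetOn c Set.univ (fun s => a 0 * T 0 s + a 1 * T 1 s + a 2 * T 2 s)
      (fun s => a 0 * n 0 s + a 1 * n 1 s + a 2 * n 2 s)
      (fun s => a 0 * b 0 s + a 1 * b 1 s + a 2 * b 2 s) :=
  (((h.frenet 0).const_mul (a 0)).add ((h.frenet 1).const_mul (a 1))).add
    ((h.frenet 2).const_mul (a 2))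

/-- Both sides solve the same system on `s > 0` and have the same limit at `0⁺`. -/
lemma bloch_eq_sum (h : FrameRows c T n b) {s : ℝ} (hs : 0 < s) :
    blochX c s = limitTangent c T n b 0 * T 0 s + limitTangent c T n b 1 * T 1 s +
        limitTangent c T n b 2 * T 2 s ∧
      blochY c s = limitTangent c T n b 0 * n 0 s + limitTangent c T n b 1 * n 1 s +
        limitTangent c T n b 2 * n 2 s := by
  have hf := (frenetOn_bloch c).sub ((h.frenet_sum (limitTangent c T n b)).mono (Set.subset_univ _))
  have hx := h.tendsto_blochX_limitTangent.sub ((((h.tendsto_T_zero 0).const_mul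
    (limitTangent c T n b 0)).add ((h.tendsto_T_zero 1).const_mul
    (limitTangent c T n b 1))).add ((h.tendsto_T_zero 2).const_mul (limitTangent c T n b 2)))
  have hy := h.tendsto_blochY_limitTangent.sub ((((h.tendsto_n_zero 0).const_mul
    (limitTangent c T n b 0)).add ((h.tendsto_n_zero 1).const_mul
    (limitTangent c T n b 1))).add ((h.tendsto_n_zero 2).const_mul (limitTangent c T n b 2)))
  have hz := h.tendsto_blochZ_limitTangent.sub ((((h.tendsto_b_zero 0).const_mul
    (limitTangent c T n b 0)).add ((h.tendsto_b_zero 1).const_mul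
    (limitTangent c T n b 1))).add ((h.tendsto_b_zero 2).const_mul (limitTangent c T n b 2)))
  have h0 := hf.eq_zero_of_tendsto (by simpa using hx) (by simpa using hy) (by simpa using hz) hs
  exact ⟨sub_eq_zero.1 h0.1, sub_eq_zero.1 h0.2.1⟩

lemma cross_rows_zero_one (h : FrameRows c T n b) (s : ℝ) :
    T 0 s * n 1 s - n 0 s * T 1 s = b 2 s :=
  (((h.frenet 0).crossProd (h.frenet 1)).eq_of_eq_zero (h.frenet 2)
    (by simp [h.T_zero, h.n_zero, h.b_zero]) (by simp [h.T_zero, h.n_zero, h.b_zero])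
    (by simp [h.T_zero, h.n_zero, h.b_zero]) s).2.2

lemma cross_rows_two_zero (h : FrameRows c T n b) (s : ℝ) :
    T 2 s * n 0 s - n 2 s * T 0 s = b 1 s :=
  (((h.frenet 2).crossProd (h.frenet 0)).eq_of_eq_zero (h.frenet 1)
    (by simp [h.T_zero, h.n_zero, h.b_zero]) (by simp [h.T_zero, h.n_zero, h.b_zero])
    (by simp [h.T_zero, h.n_zero, h.b_zero]) s).2.2

/-- This is the third component of row `0` crossed with the explicit solution, expanded in the frame
rows. It turns the variation in the curvature into the binormal component along `(0, -A₃, A₂)`. -/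
lemma bloch_cross_eq (h : FrameRows c T n b) {s : ℝ} (hs : 0 < s) :
    blochY c s * T 0 s - blochX c s * n 0 s =
      limitTangent c T n b 1 * b 2 s - limitTangent c T n b 2 * b 1 s := by
  obtain ⟨hx, hy⟩ := h.bloch_eq_sum hs
  rw [hx, hy, ← h.cross_rows_zero_one, ← h.cross_rows_two_zero]; ring

end FrameRows

/-! ### Decay towards a limit from decay of the derivative. -/

lemma hasDerivAt_inv_pow (m : ℕ) {s : ℝ} (hs : 0 < s) :
    HasDerivAt (fun s : ℝ => (s ^ m)⁻¹) (-(m * (s ^ (m + 1))⁻¹)) s := by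
  refine ((hasDerivAt_pow m s).inv (by positivity)).congr_deriv ?_
  rcases m with _ | m
  · simp
  · simp only [Nat.add_sub_cancel]
    field_simp
    ring

lemma le_of_hasDerivAt_ge {f f' : ℝ → ℝ} {D L S : ℝ} {m : ℕ} (hS : 0 < S)
    (hf : ∀ s, S ≤ s → HasDerivAt f (f' s) s)
    (hb : ∀ s, S ≤ s → -(D * (m * (s ^ (m + 1))⁻¹)) ≤ f' s) (hD : 0 ≤ D)
    (hl : Tendsto f atTop (𝓝 L)) : f S - D * (S ^ m)⁻¹ ≤ L := by
  have hd : ∀ s, S ≤ s → HasDerivAt (fun s => f s - D * (s ^ m)⁻¹)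
      (f' s - D * (-(m * (s ^ (m + 1))⁻¹))) s := fun s hs =>
    (hf s hs).sub ((hasDerivAt_inv_pow m (hS.trans_le hs)).const_mul D)
  -- The corrected function increases from `S` on and stays below `f`, so its value at `S` is at
  -- most the limit of `f`.
  have hm : MonotoneOn (fun s => f s - D * (s ^ m)⁻¹) (Set.Ici S) := by
    refine monotoneOn_of_deriv_nonneg (convex_Ici S)
      (fun s hs => (hd s hs).continuousAt.continuousWithinAt)
      (fun s hs => (hd s (interior_subset hs)).differentiableAt.differentiableWithinAt)
      (fun s hs => ?_)
    rw [(hd s (interior_subset hs)).deriv]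
    linarith [hb s (interior_subset hs)]
  refine ge_of_tendsto hl ?_
  filter_upwards [eventually_ge_atTop S] with s hs
  have h1 := hm (Set.self_mem_Ici) (Set.mem_Ici.2 hs) hs
  have h2 : 0 ≤ D * (s ^ m)⁻¹ := mul_nonneg hD (inv_nonneg.2 (pow_nonneg (hS.le.trans hs) m))
  simp only at h1
  linarith

/-- A function whose derivative decays like `s ^ (-m - 1)` approaches its limit like `s ^ (-m)`. -/
lemma abs_sub_le_of_hasDerivAt {f f' : ℝ → ℝ} {D L S : ℝ} {m : ℕ} (hS : 0 < S)
    (hf : ∀ s, S ≤ s → HasDerivAt f (f' s) s)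
    (hb : ∀ s, S ≤ s → |f' s| ≤ D * (m * (s ^ (m + 1))⁻¹)) (hD : 0 ≤ D)
    (hl : Tendsto f atTop (𝓝 L)) : |f S - L| ≤ D * (S ^ m)⁻¹ := by
  have h1 := le_of_hasDerivAt_ge hS hf (fun s hs => (abs_le.1 (hb s hs)).1) hD hl
  have h2 := le_of_hasDerivAt_ge (f := fun s => -f s) hS (fun s hs => (hf s hs).neg)
    (fun s hs => by linarith [(abs_le.1 (hb s hs)).2]) hD hl.neg
  rw [abs_le]; constructor <;> linarith

/-! ### Variation of the curvature and the binormal integral. -/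

namespace FrameRows

variable {c : ℝ} {T n b : Fin 3 → ℝ → ℝ}

/-- The derivative of the pairing does not visibly decay like `s⁻²`, but it oscillates, and one
integration by parts gains the missing decay. The factor `|k - c|` must be kept, since the bound is
later divided by it. -/
lemma pairing_tail (h : FrameRows c T n b) (hc : 0 ≤ c) {k : ℝ} (hk : 0 ≤ k) {S : ℝ} (hS : 0 < S) :
    |blochX k S * T 0 S + blochY k S * n 0 S + blochZ k S * b 0 S - limitTangent c T n b 0| ≤
      |k - c| * ((8 + 2 * (k + c) * blochConst k) / S) := by
  have hC : 0 ≤ blochConst k := by unfold blochConst; positivity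
  -- The derivative of `blochX k * b 0 - blochZ k * T 0` is `s / 2` times the oscillating integrand
  -- plus terms of order `1 / s`. Hence the weight `2 / s`.
  set Φ : ℝ → ℝ := fun s => 2 * (s ^ 1)⁻¹ * (blochX k s * b 0 s - blochZ k s * T 0 s) with hΦ
  have hΦb : ∀ s, 0 < s → |Φ s| ≤ 4 * s⁻¹ := fun s hs => by
    have h1 : |blochX k s * b 0 s| ≤ 1 := by
      rw [abs_mul]; exact mul_le_one₀ (abs_blochX_le_one k hs) (abs_nonneg _) (h.abs_b_le 0 s)
    have h2 : |blochZ k s * T 0 s| ≤ 1 := by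
      rw [abs_mul]; exact mul_le_one₀ (abs_blochZ_le_one k hs) (abs_nonneg _) (h.abs_T_le 0 s)
    have h3 : |blochX k s * b 0 s - blochZ k s * T 0 s| ≤ 2 := (abs_sub _ _).trans (by linarith)
    rw [hΦ, abs_mul, pow_one, abs_of_pos (by positivity)]
    calc 2 * s⁻¹ * _ ≤ 2 * s⁻¹ * 2 := by gcongr
      _ = _ := by ring
  have hd : ∀ s, S ≤ s → HasDerivAt (fun s => (blochX k s * T 0 s + blochY k s * n 0 s +
      blochZ k s * b 0 s) - (k - c) * Φ s)
      ((k - c) * (2 * (s ^ 2)⁻¹ * (blochX k s * b 0 s - blochZ k s * T 0 s) -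
        2 * s⁻¹ * (k * (blochY k s * b 0 s) - c * (blochZ k s * n 0 s)))) s := fun s hs => by
    have hs0 := hS.trans_le hs
    have hB := frenetOn_bloch k
    have hF := (h.frenet 0).mono (Set.subset_univ (Set.Ioi 0))
    have h1 := hB.hasDerivAt_pairing hF hs0
    have h2 := ((hasDerivAt_inv_pow 1 hs0).const_mul 2).mul
      (((hB.dx s hs0).mul (hF.dz s hs0)).sub ((hB.dz s hs0).mul (hF.dx s hs0)))
    refine (h1.sub (h2.const_mul (k - c))).congr_deriv ?_
    simp only [Pi.sub_apply, Pi.mul_apply]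
    field_simp
    push_cast
    ring
  have hl : Tendsto (fun s => (blochX k s * T 0 s + blochY k s * n 0 s +
      blochZ k s * b 0 s) - (k - c) * Φ s) atTop (𝓝 (limitTangent c T n b 0)) := by
    have h0 : Tendsto Φ atTop (𝓝 0) := by
      have h4 : Tendsto (fun s : ℝ => 4 * s⁻¹) atTop (𝓝 0) := by
        simpa using tendsto_inv_atTop_zero.const_mul (4 : ℝ)
      refine squeeze_zero_norm' ?_ h4
      filter_upwards [eventually_gt_atTop 0] with s hs using hΦb s hs
    simpa using (h.tendsto_pairing_atTop 0 k).sub (h0.const_mul (k - c))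
  have key := abs_sub_le_of_hasDerivAt (m := 1)
    (D := |k - c| * (4 + 2 * (k + c) * blochConst k)) hS hd (fun s hs => by
      have hs0 := hS.trans_le hs
      have h1 : |blochX k s * b 0 s| ≤ 1 := by
        rw [abs_mul]; exact mul_le_one₀ (abs_blochX_le_one k hs0) (abs_nonneg _) (h.abs_b_le 0 s)
      have h2 : |blochZ k s * T 0 s| ≤ 1 := by
        rw [abs_mul]; exact mul_le_one₀ (abs_blochZ_le_one k hs0) (abs_nonneg _) (h.abs_T_le 0 s)
      have h3 : |blochY k s * b 0 s| ≤ blochConst k / s := by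
        rw [abs_mul]
        exact (mul_le_of_le_one_right (abs_nonneg _) (h.abs_b_le 0 s)).trans (abs_blochY_le k hs0)
      have h4 : |blochZ k s * n 0 s| ≤ blochConst k / s := by
        rw [abs_mul]
        exact (mul_le_of_le_one_right (abs_nonneg _) (h.abs_n_le 0 s)).trans (abs_blochZ_le k hs0)
      have h5 : |blochX k s * b 0 s - blochZ k s * T 0 s| ≤ 2 := (abs_sub _ _).trans (by linarith)
      have h6 : |k * (blochY k s * b 0 s) - c * (blochZ k s * n 0 s)| ≤
          (k + c) * (blochConst k / s) := by
        refine (abs_sub _ _).trans ?_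
        rw [abs_mul k, abs_mul c, abs_of_nonneg hk, abs_of_nonneg hc, add_mul]
        gcongr
      rw [abs_mul, mul_assoc |k - c|]
      refine mul_le_mul_of_nonneg_left ((abs_sub _ _).trans ?_) (abs_nonneg _)
      rw [abs_mul, abs_mul (2 * s⁻¹), abs_of_pos (show 0 < 2 * (s ^ 2)⁻¹ by positivity),
        abs_of_pos (show 0 < 2 * s⁻¹ by positivity)]
      calc _ ≤ 2 * (s ^ 2)⁻¹ * 2 + 2 * s⁻¹ * ((k + c) * (blochConst k / s)) := by gcongr
        _ = _ := by field_simp; push_cast; ring) (by positivity) hl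
  have h1 := hΦb S hS
  have h2 : |(k - c) * Φ S| ≤ |k - c| * (4 * S⁻¹) := by
    rw [abs_mul]; gcongr
  calc _ = |((blochX k S * T 0 S + blochY k S * n 0 S + blochZ k S * b 0 S) - (k - c) * Φ S -
        limitTangent c T n b 0) + (k - c) * Φ S| := by congr 1; ring
    _ ≤ _ := (abs_add_le _ _).trans (add_le_add key h2)
    _ = _ := by field_simp; ring

/-- The integrand of the variation of the pairing with respect to the curvature. -/
def variation (T n : Fin 3 → ℝ → ℝ) (k s : ℝ) : ℝ := blochY k s * T 0 s - blochX k s * n 0 s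

lemma abs_variation_le (h : FrameRows c T n b) (k : ℝ) {s : ℝ} (hs : 0 < s) :
    |variation T n k s| ≤ 2 := by
  have h1 : |blochY k s * T 0 s| ≤ 1 := by
    rw [abs_mul]; exact mul_le_one₀ (abs_blochY_le_one k hs) (abs_nonneg _) (h.abs_T_le 0 s)
  have h2 : |blochX k s * n 0 s| ≤ 1 := by
    rw [abs_mul]; exact mul_le_one₀ (abs_blochX_le_one k hs) (abs_nonneg _) (h.abs_n_le 0 s)
  exact (abs_sub _ _).trans (by linarith)

lemma aestronglyMeasurable_variation (h : FrameRows c T n b) (k : ℝ) {S : ℝ} (hS : 0 < S) :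
    AEStronglyMeasurable (variation T n k) (volume.restrict (Set.uIoc 0 S)) := by
  rw [Set.uIoc_of_le hS.le]
  refine ContinuousOn.aestronglyMeasurable (fun s hs => ContinuousAt.continuousWithinAt ?_)
    measurableSet_Ioc
  have hB := frenetOn_bloch k
  exact ((hB.dy s hs.1).continuousAt.mul (h.continuous_T 0).continuousAt).sub
    ((hB.dx s hs.1).continuousAt.mul (h.continuous_n 0).continuousAt)

lemma intervalIntegrable_variation (h : FrameRows c T n b) (k : ℝ) {S : ℝ} (hS : 0 < S) :
    IntervalIntegrable (variation T n k) volume 0 S := by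
  refine (intervalIntegrable_const (c := (2 : ℝ))).mono_fun
    (h.aestronglyMeasurable_variation k hS) ?_
  rw [EventuallyLE, ae_restrict_iff' measurableSet_uIoc]
  refine Eventually.of_forall fun s hs => ?_
  rw [Set.uIoc_of_le hS.le] at hs
  simpa using h.abs_variation_le k hs.1

/-- The explicit solution is controlled only for `s > 0`, so the fundamental theorem is applied with
a limit at `0⁺`, where the pairing reduces to `blochX k`. -/
lemma integral_variation (h : FrameRows c T n b) (k : ℝ) {S : ℝ} (hS : 0 < S) :
    (k - c) * ∫ s in (0 : ℝ)..S, variation T n k s =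
      blochX k S * T 0 S + blochY k S * n 0 S + blochZ k S * b 0 S -
        Real.exp (-(Real.pi * (k ^ 2 / 2))) := by
  have hB := frenetOn_bloch k
  have hF := (h.frenet 0).mono (Set.subset_univ (Set.Ioi 0))
  have h0 : Tendsto (fun s => blochX k s * T 0 s + blochY k s * n 0 s + blochZ k s * b 0 s)
      (𝓝[>] 0) (𝓝 (Real.exp (-(Real.pi * (k ^ 2 / 2))))) := by
    have := (h.tendsto_pairing_zero 0 k).add (tendsto_blochX_zero k)
    simpa using this
  rw [← intervalIntegral.integral_const_mul]
  exact intervalIntegral.integral_eq_sub_of_hasDerivAt_of_tendsto hS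
    (fun s hs => hB.hasDerivAt_pairing hF hs.1)
    ((h.intervalIntegrable_variation k hS).const_mul (k - c)) h0
    ((hB.hasDerivAt_pairing hF hS).continuousAt.tendsto.mono_left nhdsWithin_le_nhds)

lemma tendsto_integral_variation (h : FrameRows c T n b) {S : ℝ} (hS : 0 < S) :
    Tendsto (fun k => ∫ s in (0 : ℝ)..S, variation T n k s) (𝓝[≠] c)
      (𝓝 (∫ s in (0 : ℝ)..S, variation T n c s)) := by
  refine intervalIntegral.tendsto_integral_filter_of_dominated_convergence (fun _ => 2)
    (Eventually.of_forall fun k => h.aestronglyMeasurable_variation k hS)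
    (Eventually.of_forall fun k => Eventually.of_forall fun s hs => ?_)
    intervalIntegrable_const (Eventually.of_forall fun s hs => ?_)
  · rw [Set.uIoc_of_le hS.le] at hs
    exact h.abs_variation_le k hs.1
  · rw [Set.uIoc_of_le hS.le] at hs
    have : Continuous fun k => variation T n k s :=
      ((continuous_blochY hs.1).mul continuous_const).sub
        ((continuous_blochX hs.1).mul continuous_const)
    exact (this.tendsto c).mono_left nhdsWithin_le_nhds

/-- Divide `integral_variation` and `pairing_tail` by `k - c` and let `k → c`: the difference
quotient of `exp (-π k² / 2)` becomes its derivative, and the tail bound survives the limit. -/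
lemma abs_integral_variation_sub_le (h : FrameRows c T n b) (hc : 0 < c) {S : ℝ} (hS : 0 < S) :
    |Real.pi * c * Real.exp (-(Real.pi * (c ^ 2 / 2))) - ∫ s in (0 : ℝ)..S, variation T n c s| ≤
      (8 + 2 * (c + c) * blochConst c) / S := by
  have hder : HasDerivAt (fun k : ℝ => Real.exp (-(Real.pi * (k ^ 2 / 2))))
      (-(Real.pi * c * Real.exp (-(Real.pi * (c ^ 2 / 2))))) c := by
    refine ((((hasDerivAt_pow 2 c).div_const 2).const_mul Real.pi).neg.exp).congr_deriv ?_
    simp only [Pi.neg_apply]; push_cast; ring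
  have h1 := hasDerivAt_iff_tendsto_slope.1 hder |>.neg
  rw [neg_neg] at h1
  have h2 := (h1.sub (h.tendsto_integral_variation hS)).abs
  have h3 : Tendsto (fun k => (8 + 2 * (k + c) * blochConst k) / S) (𝓝[≠] c)
      (𝓝 ((8 + 2 * (c + c) * blochConst c) / S)) := by
    have : Continuous fun k => (8 + 2 * (k + c) * blochConst k) / S := by
      unfold blochConst; fun_prop
    exact (this.tendsto c).mono_left nhdsWithin_le_nhds
  refine le_of_tendsto_of_tendsto h2 h3 ?_
  have hpos : ∀ᶠ k in 𝓝[≠] c, 0 < k := (eventually_gt_nhds hc).filter_mono nhdsWithin_le_nhds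
  filter_upwards [self_mem_nhdsWithin, hpos] with k hk hk0
  have hkc : 0 < |k - c| := abs_pos.2 (sub_ne_zero.2 hk)
  have h4 := h.pairing_tail hc.le hk0.le hS
  have h5 := h.integral_variation k hS
  rw [h.limitTangent_zero] at h4
  refine le_of_mul_le_mul_left ?_ hkc
  refine le_trans (le_of_eq ?_) h4
  have hk' : k - c ≠ 0 := sub_ne_zero.2 hk
  rw [← abs_mul, slope_def_field, mul_sub, h5, ← abs_neg]
  congr 1
  field_simp
  ring

/-- The improper integral of the binormal along the normal of the plane of the corner. -/
lemma tendsto_integral_binormal (h : FrameRows c T n b) (hc : 0 < c) :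
    Tendsto (fun S => ∫ s in (0 : ℝ)..S,
      (limitTangent c T n b 1 * b 2 s - limitTangent c T n b 2 * b 1 s)) atTop
      (𝓝 (Real.pi * c * Real.exp (-(Real.pi * (c ^ 2 / 2))))) := by
  rw [tendsto_iff_norm_sub_tendsto_zero]
  refine squeeze_zero' (Eventually.of_forall fun _ => norm_nonneg _) ?_
    ((tendsto_const_nhds (x := 8 + 2 * (c + c) * blochConst c)).div_atTop tendsto_id)
  filter_upwards [eventually_gt_atTop 0] with S hS
  have h1 := h.abs_integral_variation_sub_le hc hS
  rw [norm_sub_rev, Real.norm_eq_abs]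
  refine le_trans (le_of_eq ?_) h1
  congr 2
  refine intervalIntegral.integral_congr_ae (Eventually.of_forall fun s hs => ?_)
  rw [Set.uIoc_of_le hS.le] at hs
  exact (h.bloch_cross_eq hs.1).symm

end FrameRows

/-! ### Decay and integral of a component of the position. -/

namespace FrenetOn

variable {c : ℝ} {x y z : ℝ → ℝ}

/-- If the tangential component of a solution tends to zero, then the corresponding component
`s x + 2 c z` of the position decays quadratically. -/
lemma abs_position_le (h : FrenetOn c Set.univ x y z) (hc : 0 ≤ c) {C : ℝ}
    (hx : Tendsto x atTop (𝓝 0)) (hy : ∀ s, |y s| ≤ C) (hz : ∀ s, |z s| ≤ C) {S : ℝ}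
    (hS : 0 < S) : |S * x S + 2 * c * z S| ≤ (8 * c + 16 * c ^ 3 / 3) * C * (S ^ 2)⁻¹ := by
  have hC : 0 ≤ C := (abs_nonneg _).trans (hy 0)
  have hzero : ∀ m : ℕ, Tendsto (fun s : ℝ => C * (s ^ (m + 1))⁻¹) atTop (𝓝 0) := fun m => by
    simpa using ((tendsto_pow_atTop (Nat.succ_ne_zero m)).inv_tendsto_atTop).const_mul C
  have hbd : ∀ {w : ℝ → ℝ}, (∀ s, |w s| ≤ C) → ∀ m : ℕ,
      Tendsto (fun s => w s * (s ^ (m + 1))⁻¹) atTop (𝓝 0) := fun {w} hw m => by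
    refine squeeze_zero_norm' ?_ (hzero m)
    filter_upwards [eventually_gt_atTop 0] with s hs
    rw [norm_mul, Real.norm_eq_abs, Real.norm_of_nonneg (by positivity)]
    exact mul_le_mul_of_nonneg_right (hw s) (by positivity)
  -- Since `x' = -(2 c / s) z'`, adding `2 c z / s` leaves a derivative of order `s⁻²`.
  have hxdecay : ∀ s, 0 < s → |x s| ≤ 4 * c * C * s⁻¹ := fun s hs => by
    have hd : ∀ t, s ≤ t → HasDerivAt (fun t => x t + 2 * c * (z t * (t ^ 1)⁻¹))
        (-(2 * c * z t * (t ^ 2)⁻¹)) t := fun t ht => by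
      have ht0 := hs.trans_le ht
      refine ((h.dx t trivial).add (((h.dz t trivial).mul
        (hasDerivAt_inv_pow 1 ht0)).const_mul (2 * c))).congr_deriv ?_
      field_simp; push_cast; ring
    have hl : Tendsto (fun t => x t + 2 * c * (z t * (t ^ 1)⁻¹)) atTop (𝓝 0) := by
      simpa using hx.add ((hbd hz 0).const_mul (2 * c))
    have h1 := abs_sub_le_of_hasDerivAt (m := 1) (D := 2 * c * C) hs hd (fun t ht => by
      have ht0 := hs.trans_le ht
      rw [abs_neg, abs_mul, abs_mul, abs_of_nonneg (by positivity : 0 ≤ 2 * c),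
        abs_of_pos (by positivity : 0 < (t ^ 2)⁻¹)]
      push_cast; rw [one_mul]
      have := hz t
      gcongr) (by positivity) hl
    rw [sub_zero, pow_one] at h1
    have h2 : |2 * c * (z s * s⁻¹)| ≤ 2 * c * (C * s⁻¹) := by
      rw [abs_mul, abs_mul (z s), abs_of_nonneg (by positivity : 0 ≤ 2 * c),
        abs_of_pos (by positivity : 0 < s⁻¹)]
      have := hz s
      gcongr
    calc |x s| = |(x s + 2 * c * (z s * s⁻¹)) - 2 * c * (z s * s⁻¹)| := by congr 1; ring
      _ ≤ 2 * c * C * s⁻¹ + 2 * c * (C * s⁻¹) := (abs_sub _ _).trans (add_le_add h1 h2)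
      _ = _ := by ring
  -- A second integration by parts, using `z = (2 / s) (y' + c x)`: the term `4 c y / s³` cancels
  -- the derivative of order `s⁻²`, and the bound on `x` makes the remainder `O(s⁻⁴)`.
  have hd : ∀ s, S ≤ s → HasDerivAt
      (fun s => x s + 2 * c * (z s * (s ^ 1)⁻¹) + 4 * c * (y s * (s ^ 3)⁻¹))
      (-(4 * c ^ 2 * (s ^ 3)⁻¹ * x s) - 12 * c * (s ^ 4)⁻¹ * y s) s := fun s hs => by
    have hs0 := hS.trans_le hs
    refine (((h.dx s trivial).add (((h.dz s trivial).mul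
        (hasDerivAt_inv_pow 1 hs0)).const_mul (2 * c))).add (((h.dy s trivial).mul
        (hasDerivAt_inv_pow 3 hs0)).const_mul (4 * c))).congr_deriv ?_
    field_simp; push_cast; ring
  have hl : Tendsto (fun s => x s + 2 * c * (z s * (s ^ 1)⁻¹) + 4 * c * (y s * (s ^ 3)⁻¹))
      atTop (𝓝 0) := by
    simpa using (hx.add ((hbd hz 0).const_mul (2 * c))).add ((hbd hy 2).const_mul (4 * c))
  have key := abs_sub_le_of_hasDerivAt (m := 3) (D := (16 * c ^ 3 / 3 + 4 * c) * C) hS hd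
    (fun s hs => by
      have hs0 := hS.trans_le hs
      refine (abs_sub _ _).trans ?_
      rw [abs_neg, abs_mul, abs_mul _ (y s),
        abs_of_nonneg (by positivity : 0 ≤ 4 * c ^ 2 * (s ^ 3)⁻¹),
        abs_of_nonneg (by positivity : 0 ≤ 12 * c * (s ^ 4)⁻¹)]
      have h1 := hxdecay s hs0
      have h2 := hy s
      calc _ ≤ 4 * c ^ 2 * (s ^ 3)⁻¹ * (4 * c * C * s⁻¹) + 12 * c * (s ^ 4)⁻¹ * C := by gcongr
        _ = _ := by field_simp; push_cast; ring) (by positivity) hl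
  rw [sub_zero, pow_one] at key
  have h3 : |4 * c * (y S * (S ^ 2)⁻¹)| ≤ 4 * c * (C * (S ^ 2)⁻¹) := by
    rw [abs_mul, abs_mul (y S), abs_of_nonneg (by positivity : 0 ≤ 4 * c),
      abs_of_pos (by positivity : 0 < (S ^ 2)⁻¹)]
    have := hy S
    gcongr
  calc |S * x S + 2 * c * z S| = |S * (x S + 2 * c * (z S * S⁻¹) + 4 * c * (y S * (S ^ 3)⁻¹)) -
        4 * c * (y S * (S ^ 2)⁻¹)| := by congr 1; field_simp; ring
    _ ≤ S * ((16 * c ^ 3 / 3 + 4 * c) * C * (S ^ 3)⁻¹) + 4 * c * (C * (S ^ 2)⁻¹) := by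
      refine (abs_sub _ _).trans (add_le_add ?_ h3)
      rw [abs_mul, abs_of_pos hS]
      gcongr
    _ = _ := by field_simp; ring

lemma continuous_fst (h : FrenetOn c Set.univ x y z) : Continuous x :=
  continuous_iff_continuousAt.2 fun s => (h.dx s trivial).continuousAt

lemma continuous_thd (h : FrenetOn c Set.univ x y z) : Continuous z :=
  continuous_iff_continuousAt.2 fun s => (h.dz s trivial).continuousAt

lemma hasDerivAt_position (h : FrenetOn c Set.univ x y z) (s : ℝ) :
    HasDerivAt (fun s => s * x s + 2 * c * z s) (x s) s :=
  (((hasDerivAt_id s).mul (h.dx s trivial)).add ((h.dz s trivial).const_mul (2 * c))).congr_deriv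
    (by simp; ring)

/-- With `f = s x + 2 c z` one has `f' = x`, hence `(s f)' = f + s x = 2 f - 2 c z`. -/
lemma two_mul_integral_position (h : FrenetOn c Set.univ x y z) (S : ℝ) :
    2 * ∫ s in (0 : ℝ)..S, (s * x s + 2 * c * z s) =
      S * (S * x S + 2 * c * z S) + 2 * c * ∫ s in (0 : ℝ)..S, z s := by
  have hx := h.continuous_fst
  have hz := h.continuous_thd
  have h1 := intervalIntegral.integral_eq_sub_of_hasDerivAt (a := 0) (b := S)
    (f := fun s => s * (s * x s + 2 * c * z s))
    (f' := fun s => 2 * (s * x s + 2 * c * z s) - 2 * c * z s)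
    (fun s _ => ((hasDerivAt_id s).mul (h.hasDerivAt_position s)).congr_deriv (by simp; ring))
    (Continuous.intervalIntegrable (by fun_prop) _ _)
  rw [intervalIntegral.integral_sub (Continuous.intervalIntegrable (by fun_prop) _ _)
    (Continuous.intervalIntegrable (by fun_prop) _ _), intervalIntegral.integral_const_mul,
    intervalIntegral.integral_const_mul] at h1
  linarith

/-- The integral of an even, decaying position component equals `2 c` times the improper
integral of the corresponding binormal component over the half-line. -/
theorem integral_position (h : FrenetOn c Set.univ x y z) (hc : 0 ≤ c) {C L : ℝ}
    (hx : Tendsto x atTop (𝓝 0)) (hxC : ∀ s, |x s| ≤ C) (hy : ∀ s, |y s| ≤ C)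
    (hz : ∀ s, |z s| ≤ C) (hxodd : ∀ s, x (-s) = -x s) (hzeven : ∀ s, z (-s) = z s)
    (hL : Tendsto (fun S => ∫ s in (0 : ℝ)..S, z s) atTop (𝓝 L)) :
    Integrable (fun s => s * x s + 2 * c * z s) ∧ ∫ s, (s * x s + 2 * c * z s) = 2 * (c * L) := by
  have hcx := h.continuous_fst
  have hcz := h.continuous_thd
  set f : ℝ → ℝ := fun s => s * x s + 2 * c * z s with hf
  have hC : 0 ≤ C := (abs_nonneg _).trans (hy 0)
  have hcont : Continuous f := by unfold f; fun_prop
  have heven : ∀ s, f |s| = f s := fun s => by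
    rcases abs_choice s with hs | hs <;> rw [hs]
    simp only [hf, hxodd, hzeven]; ring
  set D := (8 * c + 16 * c ^ 3 / 3) * C with hD
  have hD0 : 0 ≤ D := by positivity
  have hdecay : ∀ s, 0 < s → |f s| ≤ D * (s ^ 2)⁻¹ := fun s hs => h.abs_position_le hc hx hy hz hs
  -- One integrable majorant joins the trivial bound for `|s| ≤ 1` to the quadratic decay for `|s| ≥
  -- 1`.
  have hbound : ∀ s, |f s| ≤ 2 * (D + (1 + 2 * c) * C) * (1 + s ^ 2)⁻¹ := fun s => by
    rw [← heven, ← sq_abs s]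
    have hs := abs_nonneg s
    generalize |s| = r at hs
    rw [← div_eq_mul_inv, le_div_iff₀ (by positivity)]
    rcases le_total r 1 with h1 | h1
    · have h2 : |f r| ≤ (1 + 2 * c) * C := by
        refine (abs_add_le _ _).trans ?_
        rw [abs_mul, abs_mul (2 * c), abs_of_nonneg hs, abs_of_nonneg (by positivity : 0 ≤ 2 * c)]
        have := mul_le_mul h1 (hxC r) (abs_nonneg _) zero_le_one
        have := mul_le_mul_of_nonneg_left (hz r) (by positivity : 0 ≤ 2 * c)
        linarith
      calc |f r| * (1 + r ^ 2) ≤ ((1 + 2 * c) * C) * 2 := by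
            gcongr; nlinarith
        _ ≤ _ := by linarith
    · have h2 := hdecay r (by linarith)
      have h3 : |f r| * r ^ 2 ≤ D := by
        rwa [← div_eq_mul_inv, le_div_iff₀ (by positivity)] at h2
      have h4 : |f r| ≤ |f r| * r ^ 2 := le_mul_of_one_le_right (abs_nonneg _) (one_le_pow₀ h1)
      have : 0 ≤ (1 + 2 * c) * C := by positivity
      linarith
  have hint : Integrable f := (integrable_inv_one_add_sq.const_mul _).mono'
    hcont.aestronglyMeasurable (Eventually.of_forall hbound)
  refine ⟨hint, ?_⟩
  have h1 : ∫ s, f s = 2 * ∫ s in Set.Ioi (0 : ℝ), f s := by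
    rw [← integral_comp_abs]; simp_rw [heven]
  have h2 : Tendsto (fun S => ∫ s in (0 : ℝ)..S, f s) atTop (𝓝 (∫ s in Set.Ioi (0 : ℝ), f s)) :=
    intervalIntegral_tendsto_integral_Ioi 0 hint.integrableOn tendsto_id
  have h3 : Tendsto (fun S => S * f S) atTop (𝓝 0) := by
    refine squeeze_zero_norm' ?_ ((tendsto_const_nhds (x := D)).div_atTop tendsto_id)
    filter_upwards [eventually_gt_atTop 0] with S hS
    rw [norm_mul, Real.norm_of_nonneg hS.le, Real.norm_eq_abs]
    calc S * |f S| ≤ S * (D * (S ^ 2)⁻¹) := by have := hdecay S hS; gcongr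
      _ = D / id S := by simp only [id]; field_simp
  have h4 : Tendsto (fun S => 2 * ∫ s in (0 : ℝ)..S, f s) atTop (𝓝 (0 + 2 * c * L)) :=
    (h3.add (hL.const_mul (2 * c))).congr fun S => (h.two_mul_integral_position S).symm
  have h5 := tendsto_nhds_unique (h2.const_mul 2) h4
  rw [h1, h5]; ring

end FrenetOn

/-! ### Reflection symmetry and the integral along the normal. -/

namespace FrameRows

variable {c : ℝ} {T n b : Fin 3 → ℝ → ℝ}

lemma T_zero_neg (h : FrameRows c T n b) (s : ℝ) : T 0 (-s) = T 0 s :=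
  ((h.frenet 0).reflect.eq_of_eq_zero (h.frenet 0) (by simp) (by simp [h.n_zero])
    (by simp [h.b_zero]) s).1

/-- For `i ≠ 0` the tangent entry vanishes at the origin, so the reflected row times `-1` has the
initial values of the row itself. -/
lemma reflect_eq (h : FrameRows c T n b) {i : Fin 3} (hi : i ≠ 0) (s : ℝ) :
    T i (-s) = -T i s ∧ b i (-s) = b i s := by
  have h1 := ((h.frenet i).reflect.const_mul (-1)).eq_of_eq_zero (h.frenet i)
    (by simp [h.T_zero, hi]) (by simp) (by simp) s
  exact ⟨by linarith [h1.1], by linarith [h1.2.2]⟩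

/-- The integral of the component of the position along the normal of the corner plane. -/
theorem integral_normal (h : FrameRows c T n b) (hc : 0 < c) :
    Integrable (fun s => limitTangent c T n b 1 * (s * T 2 s + 2 * c * b 2 s) -
      limitTangent c T n b 2 * (s * T 1 s + 2 * c * b 1 s)) ∧
    ∫ s, (limitTangent c T n b 1 * (s * T 2 s + 2 * c * b 2 s) -
      limitTangent c T n b 2 * (s * T 1 s + 2 * c * b 1 s)) =
      2 * Real.pi * c ^ 2 * Real.exp (-(Real.pi * (c ^ 2 / 2))) := by
  set p := limitTangent c T n b 1 with hp
  set q := limitTangent c T n b 2 with hq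
  have hsq := h.limitTangent_sq
  have hp1 : |p| ≤ 1 := by
    rw [abs_le_one_iff_mul_self_le_one]
    nlinarith [sq_nonneg (limitTangent c T n b 0), sq_nonneg q]
  have hq1 : |q| ≤ 1 := by
    rw [abs_le_one_iff_mul_self_le_one]
    nlinarith [sq_nonneg (limitTangent c T n b 0), sq_nonneg p]
  have hbd : ∀ {u v : ℝ}, |u| ≤ 1 → |v| ≤ 1 → |p * u - q * v| ≤ 2 := fun {u v} hu hv => by
    refine (abs_sub _ _).trans ?_
    rw [abs_mul, abs_mul]
    linarith [mul_le_one₀ hp1 (abs_nonneg _) hu, mul_le_one₀ hq1 (abs_nonneg _) hv]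
  have hF := ((h.frenet 2).const_mul p).sub ((h.frenet 1).const_mul q)
  -- The normal direction is orthogonal to `A⁺`: the limit is `p q - q p`.
  have hx : Tendsto (fun s => p * T 2 s - q * T 1 s) atTop (𝓝 0) := by
    have := ((h.tendsto_T_atTop 2).const_mul p).sub ((h.tendsto_T_atTop 1).const_mul q)
    rwa [← hp, ← hq, mul_comm, sub_self] at this
  have key := hF.integral_position hc.le hx (fun s => hbd (h.abs_T_le 2 s) (h.abs_T_le 1 s))
    (fun s => hbd (h.abs_n_le 2 s) (h.abs_n_le 1 s))
    (fun s => hbd (h.abs_b_le 2 s) (h.abs_b_le 1 s))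
    (fun s => by
      rw [(h.reflect_eq (by decide) s).1, (h.reflect_eq (i := 1) (by decide) s).1]; ring)
    (fun s => by
      rw [(h.reflect_eq (by decide) s).2, (h.reflect_eq (i := 1) (by decide) s).2])
    (h.tendsto_integral_binormal hc)
  have e : (fun s => s * (p * T 2 s - q * T 1 s) + 2 * c * (p * b 2 s - q * b 1 s)) =
      fun s => p * (s * T 2 s + 2 * c * b 2 s) - q * (s * T 1 s + 2 * c * b 1 s) := by
    ext s; ring
  simp only [e] at key
  refine ⟨key.1, key.2.trans (by ring)⟩

end FrameRows

/-! ### From scalar rows to the vector solution: self-similarity. -/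

lemma FrameRows.T_eq {c : ℝ} {T n b T' n' b' : Fin 3 → ℝ → ℝ} (h : FrameRows c T n b)
    (h' : FrameRows c T' n' b') (i : Fin 3) (s : ℝ) : T i s = T' i s :=
  ((h.frenet i).eq_of_eq_zero (h'.frenet i) (by rw [h.T_zero, h'.T_zero])
    (by rw [h.n_zero, h'.n_zero]) (by rw [h.b_zero, h'.b_zero]) s).1

lemma FrameRows.b_eq {c : ℝ} {T n b T' n' b' : Fin 3 → ℝ → ℝ} (h : FrameRows c T n b)
    (h' : FrameRows c T' n' b') (i : Fin 3) (s : ℝ) : b i s = b' i s :=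
  ((h.frenet i).eq_of_eq_zero (h'.frenet i) (by rw [h.T_zero, h'.T_zero])
    (by rw [h.n_zero, h'.n_zero]) (by rw [h.b_zero, h'.b_zero]) s).2.2

lemma hasDerivAt_coord {f : ℝ → E3} {f' : E3} {s : ℝ} (h : HasDerivAt f f' s) (i : Fin 3) :
    HasDerivAt (fun σ => f σ i) (f' i) s :=
  (EuclideanSpace.proj i : E3 →L[ℝ] ℝ).hasFDerivAt.comp_hasDerivAt s h

namespace IsOneCornerSolution

variable {c : ℝ} {X T n b : ℝ → ℝ → E3}

/-- The frame at any positive time, in self-similar variables. -/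
lemma frameRows (h : IsOneCornerSolution c X T n b) {t : ℝ} (ht : 0 < t) :
    FrameRows c (fun i σ => T (√t * σ) t i) (fun i σ => n (√t * σ) t i)
      (fun i σ => b (√t * σ) t i) where
  frenet i := by
    have ht' : 0 < √t := Real.sqrt_pos.2 ht
    have hsq : √t ^ 2 = t := Real.sq_sqrt ht.le
    have hl : ∀ s, HasDerivAt (fun σ => √t * σ) √t s := fun s => by
      simpa using (hasDerivAt_id s).const_mul √t
    refine ⟨fun s _ => ?_, fun s _ => ?_, fun s _ => ?_⟩
    · refine ((hasDerivAt_coord (h.hasDerivAt_T t ht _) i).comp s (hl s)).congr_deriv ?_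
      simp only [PiLp.smul_apply, smul_eq_mul]
      field_simp
    · refine ((hasDerivAt_coord (h.hasDerivAt_n t ht _) i).comp s (hl s)).congr_deriv ?_
      simp only [PiLp.add_apply, PiLp.smul_apply, smul_eq_mul]
      have e : √t * s / (2 * t) = s / (2 * √t) := by
        rw [div_eq_div_iff (by positivity) (by positivity)]
        linear_combination 2 * s * hsq
      rw [e]
      field_simp
    · refine ((hasDerivAt_coord (h.hasDerivAt_b t ht _) i).comp s (hl s)).congr_deriv ?_
      simp only [PiLp.smul_apply, smul_eq_mul]
      have e : √t * s / (2 * t) = s / (2 * √t) := by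
        rw [div_eq_div_iff (by positivity) (by positivity)]
        linear_combination 2 * s * hsq
      rw [e]
      field_simp
  T_zero i := by
    simp only [mul_zero]; rw [h.T_zero t ht]; fin_cases i <;> simp
  n_zero i := by
    simp only [mul_zero]; rw [h.n_zero t ht]; fin_cases i <;> simp
  b_zero i := by
    simp only [mul_zero]; rw [h.b_zero t ht]; fin_cases i <;> simp

lemma frameRows_one (h : IsOneCornerSolution c X T n b) :
    FrameRows c (fun i σ => T σ 1 i) (fun i σ => n σ 1 i) (fun i σ => b σ 1 i) := by
  simpa using h.frameRows one_pos

/-- The position vector in terms of the tangent and the binormal. -/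
lemma position_eq (h : IsOneCornerSolution c X T n b) {t : ℝ} (ht : 0 < t) (s : ℝ) (i : Fin 3) :
    X s t i = s * T s t i + 2 * c * √t * b s t i := by
  have ht' : 0 < √t := Real.sqrt_pos.2 ht
  have hsq : √t ^ 2 = t := Real.sq_sqrt ht.le
  have hd : ∀ s, HasDerivAt (fun s => X s t i - (s * T s t i + 2 * c * √t * b s t i)) 0 s :=
    fun s => by
    refine ((hasDerivAt_coord (h.hasDerivAt_X t ht s) i).sub
      (((hasDerivAt_id s).mul (hasDerivAt_coord (h.hasDerivAt_T t ht s) i)).add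
      ((hasDerivAt_coord (h.hasDerivAt_b t ht s) i).const_mul (2 * c * √t)))).congr_deriv ?_
    simp only [PiLp.smul_apply, smul_eq_mul, id]
    have e : s / (2 * t) = s / (2 * √t ^ 2) := by rw [hsq]
    rw [e]
    field_simp
    ring
  have h0 := is_const_of_deriv_eq_zero (fun s => (hd s).differentiableAt)
    (fun s => (hd s).deriv) s 0
  have h1 : X 0 t i - (0 * T 0 t i + 2 * c * √t * b 0 t i) = 0 := by
    rw [h.X_zero t ht, h.b_zero t ht]
    simp only [PiLp.smul_apply, smul_eq_mul]
    ring
  simp only [h1] at h0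
  linarith

/-- Self-similarity of the one-corner solution. -/
lemma position_scaling (h : IsOneCornerSolution c X T n b) {t : ℝ} (ht : 0 < t) (s : ℝ)
    (i : Fin 3) : X s t i = √t * X (s / √t) 1 i := by
  have ht' : 0 < √t := Real.sqrt_pos.2 ht
  -- In the variable `s / √t` the frames at times `t` and `1` solve the same initial value problem.
  have hT := (h.frameRows ht).T_eq h.frameRows_one i (s / √t)
  have hb := (h.frameRows ht).b_eq h.frameRows_one i (s / √t)
  simp only [mul_div_cancel₀ s ht'.ne'] at hT hb
  rw [h.position_eq ht, h.position_eq one_pos, hT, hb, Real.sqrt_one]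
  field_simp

end IsOneCornerSolution

/-! ### The plane of the corner and the rotated solution. -/

lemma tendsto_E3 {l : Filter ℝ} {f : ℝ → E3} {a : Fin 3 → ℝ}
    (h : ∀ i, Tendsto (fun s => f s i) l (𝓝 (a i))) : Tendsto f l (𝓝 (WithLp.toLp 2 a)) :=
  ((PiLp.continuous_toLp 2 fun _ : Fin 3 => ℝ).tendsto a).comp (tendsto_pi_nhds.2 h)

lemma cross_mirror (a : Fin 3 → ℝ) :
    cross (WithLp.toLp 2 ![a 0, -a 1, -a 2]) (WithLp.toLp 2 a) =
      (2 * a 0) • WithLp.toLp 2 ![0, -a 2, a 1] := by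
  ext i
  fin_cases i <;> simp [cross, crossProduct] <;> ring

lemma norm_mirror (p q : ℝ) : ‖(WithLp.toLp 2 ![0, -q, p] : E3)‖ = √(p ^ 2 + q ^ 2) := by
  rw [EuclideanSpace.norm_eq]
  congr 1
  simp [Fin.sum_univ_three]
  ring

lemma unitNormal_mirror {a : Fin 3 → ℝ} (h0 : 0 < a 0) :
    unitNormal (WithLp.toLp 2 ![a 0, -a 1, -a 2]) (WithLp.toLp 2 a) =
      (√(a 1 ^ 2 + a 2 ^ 2))⁻¹ • WithLp.toLp 2 ![0, -a 2, a 1] := by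
  rw [unitNormal, cross_mirror, norm_smul, norm_mirror, Real.norm_of_nonneg (by positivity),
    smul_smul]
  congr 1
  field_simp

lemma normalComponent_mirror {a : Fin 3 → ℝ} (h0 : 0 < a 0) (X : ℝ → ℝ → E3) (s : ℝ) :
    normalComponent (WithLp.toLp 2 ![a 0, -a 1, -a 2]) (WithLp.toLp 2 a) X s =
      (√(a 1 ^ 2 + a 2 ^ 2))⁻¹ * (a 1 * X s 1 2 - a 2 * X s 1 1) := by
  rw [normalComponent, unitNormal_mirror h0, inner_smul_left]
  simp [PiLp.inner_apply, Fin.sum_univ_three]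
  left; ring

/-- The translation is horizontal and the left factor of the rotation fixes the third axis, so the
height depends only on the factor that brings `e₀` to the vertical. -/
lemma rotatedSolution_height (M : ℕ) (a : Fin 3 → ℝ) (X : ℝ → ℝ → E3) (s t : ℝ) :
    rotatedSolution M (WithLp.toLp 2 a) X s t 2 =
      (√(a 1 ^ 2 + a 2 ^ 2))⁻¹ * (a 1 * X s t 2 - a 2 * X s t 1) := by
  simp [rotatedSolution, cornerRotation, dotProduct, Fin.sum_univ_three]
  ring

/-! ### From the height profile to the velocity, and the main theorem. -/

/-- A self-similar height profile determines the velocity of every motion linked to it. -/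
lemma velocity_eq_of_heightLink {M : ℕ} (hM : 0 < M) {Y Z : ℝ → ℝ → E3} {v : ℝ} {f : ℝ → ℝ}
    (hf : Integrable f) (hZ : ∀ t, 0 < t → ∀ s, Z s t 2 = √t * f (s / √t))
    (hv : HasVerticalVelocity Y v) (hl : HeightLink M Y Z) :
    v = M / (2 * Real.pi) * ∫ s, f s := by
  have hM' : (0 : ℝ) < M := by exact_mod_cast hM
  have hinv : Tendsto (fun t : ℝ => Real.pi / M / √t) (𝓝[>] 0) atTop := by
    have h1 : Tendsto (fun t : ℝ => √t) (𝓝[>] 0) (𝓝[>] 0) := by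
      refine tendsto_nhdsWithin_iff.2 ⟨?_, ?_⟩
      · have := (Real.continuous_sqrt.tendsto 0).mono_left (nhdsWithin_le_nhds (s := Set.Ioi 0))
        rwa [Real.sqrt_zero] at this
      · filter_upwards [self_mem_nhdsWithin] with t ht using Real.sqrt_pos.2 ht
    have h2 := (tendsto_inv_nhdsGT_zero.comp h1).const_mul_atTop
      (show 0 < Real.pi / M by positivity)
    exact h2
  have hI := intervalIntegral_tendsto_integral hf (tendsto_neg_atTop_atBot.comp hinv) hinv
  have hlim := ((hI.const_mul (M / (2 * Real.pi))).const_sub v)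
  have h0 := tendsto_nhds_unique hl (hlim.congr' ?_)
  · linarith
  filter_upwards [self_mem_nhdsWithin] with t ht
  have ht0 : 0 < t := ht
  have ht' : √t ≠ 0 := (Real.sqrt_pos.2 ht0).ne'
  have hs : √t * √t = t := Real.mul_self_sqrt ht0.le
  -- One factor `√t` comes from the height and another from the substitution, so the rise is exactly
  -- of order `t`.
  have e : ∫ s in (-(Real.pi / M))..(Real.pi / M), Z s t 2 =
      t * ∫ s in (-(Real.pi / M / √t))..(Real.pi / M / √t), f s := by
    simp_rw [hZ t ht0]
    rw [intervalIntegral.integral_const_mul, intervalIntegral.integral_comp_div _ ht', smul_eq_mul,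
      ← mul_assoc, hs, neg_div]
  rw [hv t ht0, e]
  simp only [Function.comp_apply]
  field_simp

lemma sqrt_one_sub_exp_sq (u : ℝ) :
    √(1 - Real.exp (-u) ^ 2) * Real.exp u = √(Real.exp (2 * u) - 1) := by
  have h1 : Real.exp (2 * u) - 1 = (1 - Real.exp (-u) ^ 2) * Real.exp u ^ 2 := by
    rw [sub_mul, ← mul_pow, ← Real.exp_add, ← Real.exp_nat_mul]; simp
  rw [h1, Real.sqrt_mul' _ (by positivity), Real.sqrt_sq (Real.exp_pos _).le]

lemma log_one_add_tan_sq {x : ℝ} (hx : Real.cos x ≠ 0) :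
    Real.log (1 + Real.tan x ^ 2) = -2 * Real.log (Real.cos x) := by
  have := Real.inv_one_add_tan_sq hx
  rw [← inv_inv (1 + Real.tan x ^ 2), this, Real.log_inv, Real.log_pow]
  push_cast; ring

end VortexFilament

end

theorem theorem1 (c₀ : ℝ) (hc₀ : 0 < c₀) (X T n b : ℝ → ℝ → VortexFilament.E3)
    (h : VortexFilament.IsOneCornerSolution c₀ X T n b) :
    ∃ Am Ap : VortexFilament.E3,
      Tendsto (fun s => T s 1) atBot (𝓝 Am) ∧
      Tendsto (fun s => T s 1) atTop (𝓝 Ap) ∧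
      VortexFilament.cross Am Ap ≠ 0 ∧
      Integrable (VortexFilament.normalComponent Am Ap X) ∧
      ∫ s, VortexFilament.normalComponent Am Ap X s =
        2 * Real.pi * c₀ ^ 2 / √(Real.exp (Real.pi * c₀ ^ 2) - 1) ∧
      ∀ M : ℕ, 3 ≤ M → c₀ = √(-(2 / Real.pi) * Real.log (Real.cos (Real.pi / M))) →
        (∀ s, VortexFilament.rotatedSolution M Ap X s 1 2 =
          VortexFilament.normalComponent Am Ap X s) ∧
        (M / (2 * Real.pi)) * ∫ s, VortexFilament.rotatedSolution M Ap X s 1 2 =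
          Real.log (1 + Real.tan (Real.pi / M) ^ 2) /
            ((Real.pi / M) * Real.tan (Real.pi / M)) ∧
        ∀ (XM : ℝ → ℝ → VortexFilament.E3) (cM : ℝ),
          VortexFilament.HasVerticalVelocity XM cM →
          VortexFilament.HeightLink M XM (VortexFilament.rotatedSolution M Ap X) →
          cM = Real.log (1 + Real.tan (Real.pi / M) ^ 2) /
            ((Real.pi / M) * Real.tan (Real.pi / M)) := by
  have hF := h.frameRows_one
  set a := VortexFilament.limitTangent c₀ (fun i σ => T σ 1 i) (fun i σ => n σ 1 i)
    (fun i σ => b σ 1 i) with ha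
  have ha0 : a 0 = Real.exp (-(Real.pi * (c₀ ^ 2 / 2))) := hF.limitTangent_zero
  have hpos : 0 < a 0 := by rw [ha0]; exact Real.exp_pos _
  have hlt : a 0 < 1 := by
    rw [ha0, Real.exp_lt_one_iff, neg_lt_zero]
    have := Real.pi_pos
    positivity
  have hsq : a 1 ^ 2 + a 2 ^ 2 = 1 - a 0 ^ 2 := by
    have : a 0 ^ 2 + a 1 ^ 2 + a 2 ^ 2 = 1 := hF.limitTangent_sq
    linarith
  have hr : 0 < √(a 1 ^ 2 + a 2 ^ 2) := Real.sqrt_pos.2 (by rw [hsq]; nlinarith)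
  have hnc := VortexFilament.normalComponent_mirror hpos X
  have hXrows : (fun s => a 1 * X s 1 2 - a 2 * X s 1 1) =
      fun s => a 1 * (s * T s 1 2 + 2 * c₀ * b s 1 2) - a 2 * (s * T s 1 1 + 2 * c₀ * b s 1 1) := by
    ext s
    rw [h.position_eq one_pos, h.position_eq one_pos, Real.sqrt_one, mul_one]
  obtain ⟨hint, hval⟩ := hF.integral_normal hc₀
  simp only [← ha, ← hXrows, ← ha0] at hint hval
  have hncfun : VortexFilament.normalComponent (WithLp.toLp 2 ![a 0, -a 1, -a 2])
      (WithLp.toLp 2 a) X = fun s => (√(a 1 ^ 2 + a 2 ^ 2))⁻¹ *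
        (a 1 * X s 1 2 - a 2 * X s 1 1) := funext hnc
  have hIval : ∫ s, VortexFilament.normalComponent (WithLp.toLp 2 ![a 0, -a 1, -a 2])
      (WithLp.toLp 2 a) X s =
      (√(a 1 ^ 2 + a 2 ^ 2))⁻¹ * (2 * Real.pi * c₀ ^ 2 * a 0) := by
    rw [hncfun, integral_const_mul, hval]
  have hI : Integrable (VortexFilament.normalComponent (WithLp.toLp 2 ![a 0, -a 1, -a 2])
      (WithLp.toLp 2 a) X) := by
    rw [hncfun]; exact hint.const_mul _
  refine ⟨WithLp.toLp 2 ![a 0, -a 1, -a 2], WithLp.toLp 2 a, ?_, ?_, ?_, hI, ?_, ?_⟩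
  · refine VortexFilament.tendsto_E3 fun i => ?_
    have h1 := (hF.tendsto_T_atTop i).comp tendsto_neg_atBot_atTop
    fin_cases i
    · refine h1.congr fun s => ?_
      exact hF.T_zero_neg s
    · refine h1.neg.congr fun s => ?_
      have := (hF.reflect_eq (i := 1) (by decide) s).1
      simp only [Function.comp_apply]
      simpa [neg_eq_iff_eq_neg] using this
    · refine h1.neg.congr fun s => ?_
      have := (hF.reflect_eq (i := 2) (by decide) s).1
      simp only [Function.comp_apply]
      simpa [neg_eq_iff_eq_neg] using this
  · exact VortexFilament.tendsto_E3 fun i => hF.tendsto_T_atTop i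
  · rw [VortexFilament.cross_mirror, ← norm_ne_zero_iff, norm_smul, VortexFilament.norm_mirror]
    have : ‖2 * a 0‖ ≠ 0 := norm_ne_zero_iff.2 (by positivity)
    exact mul_ne_zero this hr.ne'
  -- As `r = √(1 - A₁²)` and `A₁ = exp (-u)` with `u = π c₀² / 2`, the quotient `A₁ / r` equals `1 /
  -- √(exp (2 u) - 1)`.
  · have e := VortexFilament.sqrt_one_sub_exp_sq (Real.pi * (c₀ ^ 2 / 2))
    rw [← ha0, show 2 * (Real.pi * (c₀ ^ 2 / 2)) = Real.pi * c₀ ^ 2 by ring, ← hsq] at e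
    rw [hIval, ← e, ha0, Real.exp_neg]
    field_simp
  · intro M hM hcM
    have hM0 : (0 : ℝ) < M := by positivity
    have hM3 : (3 : ℝ) ≤ M := by exact_mod_cast hM
    have hx0 : 0 < Real.pi / M := by positivity
    have hx1 : Real.pi / M < Real.pi / 2 := by
      apply div_lt_div_of_pos_left Real.pi_pos two_pos; linarith
    have hcos : 0 < Real.cos (Real.pi / M) :=
      Real.cos_pos_of_mem_Ioo ⟨by linarith, hx1⟩
    have hsin : 0 < Real.sin (Real.pi / M) := Real.sin_pos_of_pos_of_lt_pi hx0 (by linarith)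
    have hc2 : c₀ ^ 2 = -(2 / Real.pi) * Real.log (Real.cos (Real.pi / M)) := by
      conv_lhs => rw [hcM]
      exact Real.sq_sqrt (Real.sqrt_pos.1 (hcM ▸ hc₀)).le
    -- The prescribed `c₀` is the one for which the limiting tangents form the corner angle of the
    -- regular `M`-gon.
    have hacos : a 0 = Real.cos (Real.pi / M) := by
      rw [ha0, hc2, ← Real.exp_log hcos]
      congr 1
      rw [Real.exp_log hcos]
      field_simp
    have hrsin : √(a 1 ^ 2 + a 2 ^ 2) = Real.sin (Real.pi / M) := by
      rw [hsq, hacos, ← Real.sin_sq, Real.sqrt_sq hsin.le]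
    have hrot : ∀ s, VortexFilament.rotatedSolution M (WithLp.toLp 2 a) X s 1 2 =
        VortexFilament.normalComponent (WithLp.toLp 2 ![a 0, -a 1, -a 2])
          (WithLp.toLp 2 a) X s := fun s => by
      rw [hnc, VortexFilament.rotatedSolution_height]
    have hmean : (M / (2 * Real.pi)) * ∫ s, VortexFilament.normalComponent
        (WithLp.toLp 2 ![a 0, -a 1, -a 2]) (WithLp.toLp 2 a) X s =
        Real.log (1 + Real.tan (Real.pi / M) ^ 2) /
          ((Real.pi / M) * Real.tan (Real.pi / M)) := by
      rw [hIval, VortexFilament.log_one_add_tan_sq hcos.ne', hrsin, hacos, hc2,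
        Real.tan_eq_sin_div_cos]
      have := Real.pi_pos
      field_simp
    refine ⟨hrot, ?_, fun XM cM hv hl => ?_⟩
    · simp_rw [hrot]; exact hmean
    · rw [← hmean]
      refine VortexFilament.velocity_eq_of_heightLink (by omega) hI (fun t ht s => ?_) hv hl
      rw [VortexFilament.rotatedSolution_height, hnc, h.position_scaling ht, h.position_scaling ht]
      ring
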